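/- Euler sums. For positive integers $s_1,\dots,s_d$ and signs $z_1,\dots,z_d\in\{\pm1\}$ let $$\zeta^{(M)}(s_1,\dots,s_d;z_1,\dots,z_d)=\sum_{M\ge n_1>\cdots>n_d>0}\frac{z_1^{n_1}\cdots z_d^{n_d}}{n_1^{s_1}\cdots n_d^{s_d}},\qquad I^{(\varepsilon)}(s_1,\dots,s_d;z_1,\dots,z_d)=\int_0^{1-\varepsilon}\Big(\frac{dt}{t}\Big)^{s_1-1}\frac{dt}{a_1-t}\cdots\Big(\frac{dt}{t}\Big)^{s_d-1}\frac{dt}{a_d-t},$$ an iterated integral over $1-\varepsilon>t_1>t_2>\cdots>0$ with $a_k=z_1\cdots z_k$. If $(s_1,z_1)\neq(1,1)$ the index is called admissible, and $\zeta(s_1,\dots,s_d;z_1,\dots,z_d)=\lim_{M\to\infty}\zeta^{(M)}$. For every index let $\zeta_*$ and $\zeta_{\mathrm{sh}}$ be its stuffle and shuffle regularizations, i.e. the unique polynomials in $\mathbb R[T]$ such that $$\zeta^{(M)}=\zeta_*(\log M+\gamma)+o(1)\quad(M\to\infty),\qquad I^{(\varepsilon)}=\zeta_{\mathrm{sh}}(-\log\varepsilon)+o(1)\quad(\varepsilon\to0^+),$$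 where $\gamma$ is Euler's constant. A bar over $s_j$ means $z_j=-1$, no bar means $z_j=1$. Theorem. For every index of depth $d\le 3$ the polynomials $\zeta_*$ and $\zeta_{\mathrm{sh}}$ exist, and for every admissible index of depth $d\le3$ the limit $\zeta$ exists. Let $w\ge4$, $u=w-2$, $v=w-1$, and let $\sum$ denote the sum over all pairs of positive integers $(b,c)$ with $b+c=w-1$. Then (as identities in $\mathbb R[T]$ where regularized values occur) \begin{align*} \sum\zeta_{\mathrm{sh}}(1,b,c)&=\zeta(2,u)+\zeta_*(1,v)+\zeta_*(1,1,u)-\tfrac12\zeta(2)\zeta(u),\\ \sum\zeta_{\mathrm{sh}}(1,\bar b,c)&=\zeta(\bar2,\bar u)+\zeta_*(1,v)+\zeta_*(1,\bar1,\bar u)+\zeta_*(1,\bar u,\bar1)+\zeta(\bar1,1,\bar u)-\zeta(\bar1,\bar1,\bar u)-\zeta_*(1,\bar u,1),\\ \sum\zeta(\bar1,b,c)&=\zeta(2,u)+\zeta(\bar1,\bar v)+\zeta(\bar1,u,\bar1)+2\zeta(\bar1,\bar1,u)-\zeta(\bar1,1,u)-\zeta(\bar1,u,1),\\ \sum\zeta(\bar1,\bar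 b,c)&=\zeta(\bar2,\bar u)+\zeta(\bar1,\bar v)+\zeta(\bar1,1,\bar u),\\ \sum\zeta(\bar1,\bar b,\bar c)&=\zeta(\bar2,u)+\zeta(\bar1,v)+\zeta(\bar1,u,1)+\zeta(\bar1,1,u)-\zeta(\bar1,u,\bar1),\\ \sum\zeta_{\mathrm{sh}}(1,b,\bar c)&=\zeta(2,\bar u)+\zeta_*(1,\bar v)+\zeta_*(1,\bar u,1)+\zeta_*(1,1,\bar u)-\zeta_{\mathrm{sh}}(1,\bar u,\bar1)-\tfrac12\zeta(2)\zeta(\bar u),\\ \sum\zeta_{\mathrm{sh}}(1,\bar b,\bar c)&=\zeta(\bar2,u)+\zeta_*(1,\bar v)+\zeta_*(1,\bar1,u)+\zeta(\bar1,1,u)-\zeta(\bar1,\bar1,u),\\ \sum\zeta(\bar1,b,\bar c)&=\zeta(2,\bar u)+\zeta(\bar1,v)+2\zeta(\bar1,\bar1,\bar u)-\zeta(\bar1,1,\bar u). \end{align*} -/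

import Mathlib

open Filter Topology Polynomial

noncomputable section

namespace EulerSums

/-- A signed entry `(s, z)`: an exponent `s` together with a sign `z = ±1`. -/
abbrev Entry := ℕ × ℤˣ

/-- The entry `n` without a bar, i.e. exponent `n` and sign `1`. -/
def pos (n : ℕ) : Entry := (n, 1)

/-- The entry `n` with a bar, i.e. exponent `n` and sign `-1`. -/
def bar (n : ℕ) : Entry := (n, -1)

/-- All exponents are positive integers. -/
def IsIndex (l : List Entry) : Prop := ∀ e ∈ l, 1 ≤ e.1

/-- A nonempty index is admissible if its first entry is not `(1, 1)`. -/
def IsAdmissible (l : List Entry) : Prop := IsIndex l ∧ l ≠ [] ∧ l.head? ≠ some (pos 1)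

/-- The truncated Euler sum
`ζ^(M)(s; z) = ∑_{M ≥ n₁ > n₂ > ⋯ > n_d > 0} ∏ⱼ zⱼ ^ nⱼ / nⱼ ^ sⱼ`, summed from the outermost
variable `n₁` inwards. -/
def truncSum : List Entry → ℕ → ℝ
  | [], _ => 1
  | (s, z) :: l, M =>
      ∑ n ∈ Finset.Icc 1 M, (((z : ℤ) : ℝ) ^ n / (n : ℝ) ^ s) * truncSum l (n - 1)

/-- The Euler sum `ζ(s; z)`, the limit of its truncations as `M → ∞`. -/
def eulerSum (l : List Entry) : ℝ := limUnder atTop (truncSum l)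

/-- The iterated integral
`∫_{x > t₁ > t₂ > ⋯ > 0} f₁(t₁) f₂(t₂) ⋯ dt₁ dt₂ ⋯` of a list of densities. -/
def iterInt : List (ℝ → ℝ) → ℝ → ℝ
  | [], _ => 1
  | f :: fs, x => ∫ t in (0 : ℝ)..x, f t * iterInt fs t

/-- The densities of the word `(dt/t)^(s₁-1) dt/(a₁-t) ⋯ (dt/t)^(s_d-1) dt/(a_d-t)`, where
`a_k = a * z₁ ⋯ z_k`. -/
def forms : ℤˣ → List Entry → List (ℝ → ℝ)
  | _, [] => []
  | a, (s, z) :: l =>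
      List.replicate (s - 1) (fun t : ℝ => 1 / t) ++
        (fun t : ℝ => 1 / ((((a * z : ℤˣ) : ℤ) : ℝ) - t)) :: forms (a * z) l

/-- The truncated iterated integral `I^(ε)(s; z)`, over `[0, 1 - ε]`. Since the signs are `±1`,
the partial products of the `zⱼ` and of the `zⱼ⁻¹` agree. -/
def truncInt (l : List Entry) (ε : ℝ) : ℝ := iterInt (forms 1 l) (1 - ε)

/-- `P` is the stuffle regularization of the index: `ζ^(M)(s; z) = P(log M + γ) + o(1)`
as `M → ∞`, where `γ` is Euler's constant. -/
def IsStuffleReg (l : List Entry) (P : ℝ[X]) : Prop :=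
  Tendsto (fun M : ℕ => truncSum l M - P.eval (Real.log M + Real.eulerMascheroniConstant))
    atTop (𝓝 0)

/-- `P` is the shuffle regularization of the index: `I^(ε)(s; z) = P(-log ε) + o(1)`
as `ε → 0⁺`. -/
def IsShuffleReg (l : List Entry) (P : ℝ[X]) : Prop :=
  Tendsto (fun ε : ℝ => truncInt l ε - P.eval (-Real.log ε)) (𝓝[>] 0) (𝓝 0)

/-- A polynomial that tends to zero along a path going to infinity is zero. -/
theorem eq_zero_of_tendsto {α : Type*} {l : Filter α} [l.NeBot] {x : α → ℝ}
    (hx : Tendsto x l atTop) {R : ℝ[X]} (h : Tendsto (fun i => R.eval (x i)) l (𝓝 0)) :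
    R = 0 := by
  by_cases hd : 0 < R.degree
  · have h1 := (R.abs_tendsto_atTop hd).comp hx
    have h2 := h.abs
    exact absurd h2 (not_tendsto_nhds_of_tendsto_atTop h1 _)
  · rw [Polynomial.eq_C_of_degree_le_zero (not_lt.mp hd)] at h ⊢
    simp only [Polynomial.eval_C] at h
    rw [tendsto_nhds_unique tendsto_const_nhds h, Polynomial.C_0]

/-- The stuffle regularization is unique. -/
theorem IsStuffleReg.unique {l : List Entry} {P Q : ℝ[X]} (hP : IsStuffleReg l P)
    (hQ : IsStuffleReg l Q) : P = Q := by
  have hx : Tendsto (fun M : ℕ => Real.log M + Real.eulerMascheroniConstant) atTop atTop :=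
    tendsto_atTop_add_const_right _ _ (Real.tendsto_log_atTop.comp tendsto_natCast_atTop_atTop)
  refine sub_eq_zero.mp (eq_zero_of_tendsto hx ?_)
  have h := hQ.sub hP
  simpa using h

/-- The shuffle regularization is unique. -/
theorem IsShuffleReg.unique {l : List Entry} {P Q : ℝ[X]} (hP : IsShuffleReg l P)
    (hQ : IsShuffleReg l Q) : P = Q := by
  have hx : Tendsto (fun ε : ℝ => -Real.log ε) (𝓝[>] 0) atTop :=
    tendsto_neg_atBot_atTop.comp Real.tendsto_log_nhdsGT_zero
  refine sub_eq_zero.mp (eq_zero_of_tendsto hx ?_)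
  have h := hQ.sub hP
  simpa using h

open Classical in
/-- The stuffle-regularized Euler sum `ζ_*(s; z)`, a polynomial in `T`: the unique polynomial
`P` with `ζ^(M)(s; z) = P(log M + γ) + o(1)`. -/
def zetaStar (l : List Entry) : ℝ[X] :=
  if h : ∃ P, IsStuffleReg l P then h.choose else 0

open Classical in
/-- The shuffle-regularized Euler sum `ζ_ш(s; z)`, a polynomial in `T`: the unique polynomial
`P` with `I^(ε)(s; z) = P(-log ε) + o(1)`. -/
def zetaSha (l : List Entry) : ℝ[X] :=
  if h : ∃ P, IsShuffleReg l P then h.choose else 0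

/-- The pairs `(b, c)` of positive integers with `b + c = n`. -/
def pairs (n : ℕ) : Finset (ℕ × ℕ) :=
  (Finset.HasAntidiagonal.antidiagonal n).filter (fun p => 1 ≤ p.1 ∧ 1 ≤ p.2)

end EulerSums

end

open EulerSums

/-!
Cut off the iterated integral of an index at `x = 1 - ε`. As a power series in `x`, its
coefficients are the increments of the truncated sums `ζ^(M)`, so `I^(ε) / ε` is the generating
function of `ζ^(M)`. Only leading entries `1` make `ζ^(M)` diverge, and summing against `1 / n`
once for each of them shows that `ζ^(M)` is, up to `O(M ^ (-1/2))`, a linear combination of the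
sums `ζ^(M)(1, …, 1)`. By the stuffle product these are asymptotically polynomials in `log M + γ`,
while by the shuffle product the integrals with the same indices are the powers
`(-log ε) ^ k / k!`. Both regularizations therefore exist, and they are given by the same
coefficients: they agree for indices with at most one leading `1`, and differ by `½ ζ(2) ζ(l)` for
an index `(1, 1, l)` with `l` admissible.

The sum formulas are double shuffle relations. Multiplying an iterated integral by that of the
letter `dt/(q - t)` inserts the letter in all places of the word; for the word of `(1, u)` the
insertions between the letters `dt/t` produce the sum over `b + c = u + 1`. Comparing with the
stuffle product of the same two indices evaluates this sum, for each choice of signs.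
-/

namespace EulerSums

open Asymptotics
open PowerSeries (derivative constantCoeff coeff)

/-! ### Stuffle product with a single entry -/

theorem IsIndex.of_cons {e : Entry} {l : List Entry} (h : IsIndex (e :: l)) : IsIndex l :=
  fun f hf => h f (List.mem_cons_of_mem e hf)

theorem truncSum_cons_zero (e : Entry) (l : List Entry) : truncSum (e :: l) 0 = 0 := by
  simp [truncSum]

theorem truncSum_cons_succ (s : ℕ) (z : ℤˣ) (l : List Entry) (n : ℕ) :
    truncSum ((s, z) :: l) (n + 1) = truncSum ((s, z) :: l) n +
      ((z : ℤ) : ℝ) ^ (n + 1) / ((n : ℝ) + 1) ^ s * truncSum l n := by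
  simp only [truncSum, Finset.sum_Icc_succ_top (Nat.le_add_left 1 n), Nat.cast_add, Nat.cast_one,
    Nat.add_sub_cancel]

/-- The entry in which two entries of a stuffle product coincide: exponents add and signs
multiply. -/
def merge (e f : Entry) : Entry := (e.1 + f.1, e.2 * f.2)

theorem truncSum_singleton_mul (e : Entry) (l : List Entry) (n : ℕ) :
    truncSum [e] n * truncSum l n =
      ∑ i ∈ Finset.range (l.length + 1), truncSum (l.insertIdx i e) n +
        ∑ i ∈ Finset.range l.length, truncSum (l.modify i (merge e)) n := by
  induction l generalizing n with
  | nil => simp [truncSum]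
  | cons f l ih =>
    obtain ⟨s, z⟩ := e
    obtain ⟨t, y⟩ := f
    simp only [List.length_cons, Finset.sum_range_succ' _ (l.length + 1),
      Finset.sum_range_succ' _ l.length, List.insertIdx_succ_cons, List.insertIdx_zero,
      List.modify_succ_cons, List.modify_zero_cons, merge] at ih ⊢
    induction n with
    | zero => simp [truncSum_cons_zero]
    | succ n ihn =>
      have hmerge : ((z : ℤ) : ℝ) ^ (n + 1) / ((n : ℝ) + 1) ^ s *
          (((y : ℤ) : ℝ) ^ (n + 1) / ((n : ℝ) + 1) ^ t) =
          (((z * y : ℤˣ) : ℤ) : ℝ) ^ (n + 1) / ((n : ℝ) + 1) ^ (s + t) := by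
        rw [div_mul_div_comm, ← mul_pow, ← pow_add, Units.val_mul, Int.cast_mul]
      simp only [truncSum_cons_succ, Finset.sum_add_distrib, ← Finset.mul_sum] at ihn ⊢
      rw [← hmerge]
      have hone : truncSum [] n = 1 := rfl
      rw [hone]
      linear_combination ihn + ((y : ℤ) : ℝ) ^ (n + 1) / ((n : ℝ) + 1) ^ t * ih n

/-! ### Words and formal iterated integrals -/

/-- The density of a letter: `none` stands for `dt/t` and `some a` for `dt/(a - t)`. -/
noncomputable def letterForm : Option ℤˣ → ℝ → ℝ
  | none => fun t => 1 / t
  | some a => fun t => 1 / (((a : ℤ) : ℝ) - t)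

/-- The word of letters whose iterated integral is attached to an index; as in `forms`, the
letters are the partial products of the signs, starting from `a`. -/
def word : ℤˣ → List Entry → List (Option ℤˣ)
  | _, [] => []
  | a, (s, z) :: l => List.replicate (s - 1) none ++ some (a * z) :: word (a * z) l

theorem forms_eq_map_word (a : ℤˣ) (l : List Entry) : forms a l = (word a l).map letterForm := by
  induction l generalizing a with
  | nil => rfl
  | cons e l ih => simp [forms, word, ih, letterForm]

/-- The expansion of `1 / (a - t)` at `t = 0` for a sign `a`; it uses `a⁻¹ = a`. -/
noncomputable def letterSeries (a : ℤˣ) : PowerSeries ℝ :=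
  PowerSeries.mk fun k => ((a : ℤ) : ℝ) ^ (k + 1)

/-- The primitive with constant term zero. -/
noncomputable def formalInt (f : PowerSeries ℝ) : PowerSeries ℝ :=
  PowerSeries.mk fun n => coeff (n - 1) f / n

/-- The power series at `0` of the iterated integral of a word. For `dt/t` the constant term of
the integrand is discarded, so the series is the right one when that term is zero. -/
noncomputable def wordSeries : List (Option ℤˣ) → PowerSeries ℝ
  | [] => 1
  | none :: w => formalInt (PowerSeries.mk fun n => coeff (n + 1) (wordSeries w))
  | some a :: w => formalInt (letterSeries a * wordSeries w)

/-- The word does not end in `dt/t`, so its iterated integral converges at `0`. -/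
def IsConvergent (w : List (Option ℤˣ)) : Prop := w.getLast? ≠ some none

theorem coeff_zero_formalInt (f : PowerSeries ℝ) : coeff 0 (formalInt f) = 0 := by
  simp [formalInt]

theorem coeff_succ_formalInt (f : PowerSeries ℝ) (n : ℕ) :
    coeff (n + 1) (formalInt f) = coeff n f / ((n : ℝ) + 1) := by
  simp [formalInt]

theorem derivative_formalInt (f : PowerSeries ℝ) : derivative ℝ (formalInt f) = f := by
  ext n
  rw [PowerSeries.coeff_derivative, coeff_succ_formalInt, div_mul_cancel₀ _ (by positivity)]

theorem constantCoeff_wordSeries_cons (x : Option ℤˣ) (w : List (Option ℤˣ)) :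
    constantCoeff (wordSeries (x :: w)) = 0 := by
  rw [← PowerSeries.coeff_zero_eq_constantCoeff_apply]
  cases x <;> exact coeff_zero_formalInt _

theorem IsConvergent.of_cons {x : Option ℤˣ} {w : List (Option ℤˣ)}
    (h : IsConvergent (x :: w)) : IsConvergent w := by
  cases w with
  | nil => simp [IsConvergent]
  | cons y w => simpa [IsConvergent] using h

theorem IsConvergent.constantCoeff_wordSeries {w : List (Option ℤˣ)}
    (h : IsConvergent (none :: w)) : constantCoeff (wordSeries w) = 0 := by
  cases w with
  | nil => simp [IsConvergent] at h
  | cons y w => exact constantCoeff_wordSeries_cons y w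

theorem IsConvergent.insertIdx {w : List (Option ℤˣ)} (h : IsConvergent w) (q : ℤˣ) (i : ℕ) :
    IsConvergent (w.insertIdx i (some q)) := by
  induction w generalizing i with
  | nil => cases i <;> simp [IsConvergent]
  | cons x w ih =>
    rcases i with _ | i
    · simpa [IsConvergent] using h
    · rw [List.insertIdx_succ_cons]
      have hi := ih h.of_cons i
      cases hw : w.insertIdx i (some q) with
      | nil => cases w <;> cases i <;> simp_all
      | cons y v => simpa [IsConvergent, hw] using hi

theorem isConvergent_word (a : ℤˣ) (l : List Entry) : IsConvergent (word a l) := by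
  induction l generalizing a with
  | nil => simp [word, IsConvergent]
  | cons e l ih =>
    have hl := ih (a * e.2)
    simp only [word, IsConvergent, List.getLast?_append, List.getLast?_cons] at hl ⊢
    cases h : (word (a * e.2) l).getLast? <;> simp_all

theorem X_mul_derivative_wordSeries_none {w : List (Option ℤˣ)} (h : IsConvergent (none :: w)) :
    PowerSeries.X * derivative ℝ (wordSeries (none :: w)) = wordSeries w := by
  rw [wordSeries, derivative_formalInt, ← PowerSeries.sub_const_eq_X_mul_shift,
    h.constantCoeff_wordSeries, map_zero, sub_zero]

theorem ext_of_X_mul_derivative {f g : PowerSeries ℝ}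
    (h : PowerSeries.X * derivative ℝ f = PowerSeries.X * derivative ℝ g)
    (hc : constantCoeff f = constantCoeff g) : f = g :=
  PowerSeries.derivative.ext (mul_left_cancel₀ PowerSeries.X_ne_zero h) hc

theorem wordSeries_singleton_mul (q : ℤˣ) {w : List (Option ℤˣ)} (hw : IsConvergent w) :
    wordSeries [some q] * wordSeries w =
      ∑ i ∈ Finset.range (w.length + 1), wordSeries (w.insertIdx i (some q)) := by
  induction w with
  | nil => simp [wordSeries]
  | cons x w ih =>
    rw [List.length_cons, Finset.sum_range_succ']
    simp only [List.insertIdx_succ_cons, List.insertIdx_zero]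
    refine ext_of_X_mul_derivative ?_ (by simp [constantCoeff_wordSeries_cons])
    specialize ih hw.of_cons
    have hq : derivative ℝ (wordSeries [some q]) = letterSeries q := by
      simp only [wordSeries, mul_one, derivative_formalInt]
    rw [Derivation.leibniz, map_add, map_sum, hq, smul_eq_mul, smul_eq_mul]
    cases x with
    | none =>
      have hins (i : ℕ) : PowerSeries.X *
          derivative ℝ (wordSeries (none :: w.insertIdx i (some q))) =
            wordSeries (w.insertIdx i (some q)) :=
        X_mul_derivative_wordSeries_none (hw.insertIdx q (i + 1))
      have hnone := X_mul_derivative_wordSeries_none hw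
      have hsome : derivative ℝ (wordSeries (some q :: none :: w)) =
          letterSeries q * wordSeries (none :: w) := derivative_formalInt _
      rw [mul_add, mul_add, Finset.mul_sum, Finset.sum_congr rfl fun i _ => hins i, ← ih, hsome]
      linear_combination wordSeries [some q] * hnone
    | some p =>
      have hsome (r : ℤˣ) (v : List (Option ℤˣ)) : derivative ℝ (wordSeries (some r :: v)) =
          letterSeries r * wordSeries v := derivative_formalInt _
      simp only [hsome, ← Finset.mul_sum, ← ih]
      ring

theorem coeff_succ_letterSeries_mul (a : ℤˣ) (f : PowerSeries ℝ) (n : ℕ) :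
    coeff (n + 1) (letterSeries a * f) =
      ((a : ℤ) : ℝ) * (coeff n (letterSeries a * f) + coeff (n + 1) f) := by
  rw [PowerSeries.coeff_mul, PowerSeries.coeff_mul, Finset.Nat.sum_antidiagonal_succ, mul_add,
    Finset.mul_sum, add_comm]
  simp only [letterSeries, PowerSeries.coeff_mk, pow_succ, pow_zero, one_mul]
  exact congrArg (· + _) (Finset.sum_congr rfl fun _ _ => by ring)

theorem coeff_succ_wordSeries_replicate (k n : ℕ) (w : List (Option ℤˣ)) :
    coeff (n + 1) (wordSeries (List.replicate k none ++ w)) =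
      coeff (n + 1) (wordSeries w) / ((n : ℝ) + 1) ^ k := by
  induction k with
  | zero => simp
  | succ k ih =>
    rw [List.replicate_succ, List.cons_append, wordSeries, coeff_succ_formalInt,
      PowerSeries.coeff_mk, ih, div_div, ← pow_succ]

theorem coeff_letterSeries_mul_wordSeries_word (a : ℤˣ) {l : List Entry} (hl : IsIndex l)
    (n : ℕ) :
    coeff n (letterSeries a * wordSeries (word a l)) =
      ((a : ℤ) : ℝ) ^ (n + 1) * truncSum l n := by
  induction l generalizing a n with
  | nil => simp [word, wordSeries, letterSeries, truncSum]
  | cons e l ih =>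
    obtain ⟨s, z⟩ := e
    induction n with
    | zero =>
      have hconst : constantCoeff (wordSeries (word a ((s, z) :: l))) = 0 := by
        rw [word]
        cases s - 1 <;> exact constantCoeff_wordSeries_cons _ _
      simp [truncSum_cons_zero, hconst]
    | succ n ihn =>
      obtain ⟨t, rfl⟩ : ∃ t, s = t + 1 := Nat.exists_eq_add_of_le' (hl (s, z) List.mem_cons_self)
      have hcoeff : coeff (n + 1) (wordSeries (word a ((t + 1, z) :: l))) =
          ((a * z : ℤˣ) : ℤ) ^ (n + 1) * truncSum l n / ((n : ℝ) + 1) ^ (t + 1) := by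
        rw [word, coeff_succ_wordSeries_replicate, wordSeries, coeff_succ_formalInt,
          ih (a * z) hl.of_cons, div_div, Nat.add_sub_cancel, pow_succ' _ t]
      rw [coeff_succ_letterSeries_mul, ihn, hcoeff, truncSum_cons_succ]
      push_cast
      ring

/-! ### Values of power series on `(0, 1)` -/

/-- The power series `f` converges on `(0, 1)`, to the function `F`. The endpoint `0` is left out
because `dt/t` has a junk value there. -/
def HasValue (f : PowerSeries ℝ) (F : ℝ → ℝ) : Prop :=
  ∀ x ∈ Set.Ioo (0 : ℝ) 1, HasSum (fun n => coeff n f * x ^ n) (F x)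

theorem HasValue.unique {f : PowerSeries ℝ} {F G : ℝ → ℝ} (hF : HasValue f F)
    (hG : HasValue f G) : Set.EqOn F G (Set.Ioo 0 1) := fun x hx => (hF x hx).unique (hG x hx)

theorem HasValue.sub {f g : PowerSeries ℝ} {F G : ℝ → ℝ} (hf : HasValue f F)
    (hg : HasValue g G) : HasValue (f - g) fun x => F x - G x := by
  intro x hx
  simpa only [map_sub, sub_mul] using (hf x hx).sub (hg x hx)

theorem HasValue.smul (c : ℝ) {f : PowerSeries ℝ} {F : ℝ → ℝ} (hf : HasValue f F) :
    HasValue (c • f) fun x => c * F x := by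
  intro x hx
  simpa only [map_smul, smul_eq_mul, mul_assoc] using (hf x hx).mul_left c

theorem HasValue.sum {ι : Type*} {s : Finset ι} {f : ι → PowerSeries ℝ} {F : ι → ℝ → ℝ}
    (h : ∀ i ∈ s, HasValue (f i) (F i)) :
    HasValue (∑ i ∈ s, f i) fun x => ∑ i ∈ s, F i x := by
  intro x hx
  simpa only [map_sum, Finset.sum_mul] using hasSum_sum fun i hi => h i hi x hx

theorem HasValue.mul {f g : PowerSeries ℝ} {F G : ℝ → ℝ} (hf : HasValue f F)
    (hg : HasValue g G) : HasValue (f * g) fun x => F x * G x := by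
  intro x hx
  have hcoeff (n : ℕ) : coeff n (f * g) * x ^ n =
      ∑ kl ∈ Finset.HasAntidiagonal.antidiagonal n,
        (coeff kl.1 f * x ^ kl.1) * (coeff kl.2 g * x ^ kl.2) := by
    rw [PowerSeries.coeff_mul, Finset.sum_mul]
    refine Finset.sum_congr rfl fun kl hkl => ?_
    rw [← Finset.HasAntidiagonal.mem_antidiagonal.mp hkl, pow_add]
    ring
  have hsf := (hf x hx).summable.norm
  have hsg := (hg x hx).summable.norm
  simp only [hcoeff]
  rw [← (hf x hx).tsum_eq, ← (hg x hx).tsum_eq,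
    tsum_mul_tsum_eq_tsum_sum_antidiagonal_of_summable_norm hsf hsg]
  exact (summable_norm_sum_mul_antidiagonal_of_summable_norm hsf hsg).of_norm.hasSum

theorem abs_cast_units (z : ℤˣ) : |((z : ℤ) : ℝ)| = 1 := by
  rcases Int.units_eq_one_or z with rfl | rfl <;> simp

theorem hasValue_letterSeries (a : ℤˣ) : HasValue (letterSeries a) (letterForm (some a)) := by
  intro x hx
  have ha : ((a : ℤ) : ℝ) * ((a : ℤ) : ℝ) = 1 := by
    rw [← abs_mul_abs_self, abs_cast_units, one_mul]
  have hax : |((a : ℤ) : ℝ) * x| < 1 := by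
    rw [abs_mul, abs_cast_units, one_mul, abs_of_pos hx.1]
    exact hx.2
  have hvalue : letterForm (some a) x = ((a : ℤ) : ℝ) * (1 - ((a : ℤ) : ℝ) * x)⁻¹ := by
    have hfactor : ((a : ℤ) : ℝ) - x = ((a : ℤ) : ℝ) * (1 - ((a : ℤ) : ℝ) * x) := by
      linear_combination x * ha
    simp only [letterForm]
    rw [hfactor, one_div, mul_inv, inv_eq_of_mul_eq_one_left ha]
  rw [hvalue]
  refine ((hasSum_geometric_of_abs_lt_one hax).mul_left _).congr_fun fun n => ?_
  rw [letterSeries, PowerSeries.coeff_mk]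
  ring

theorem HasValue.integral {f : PowerSeries ℝ} {F : ℝ → ℝ} (h : HasValue f F) :
    HasValue (formalInt f) fun x => ∫ t in (0 : ℝ)..x, F t := by
  intro x hx
  rw [← hasSum_nat_add_iff' 1]
  have hterm (n : ℕ) : coeff (n + 1) (formalInt f) * x ^ (n + 1) =
      ∫ t in (0 : ℝ)..x, coeff n f * t ^ n := by
    rw [intervalIntegral.integral_const_mul, integral_pow, coeff_succ_formalInt]
    ring
  simp only [Finset.sum_range_one, coeff_zero_formalInt, zero_mul, sub_zero, hterm]
  refine intervalIntegral.hasSum_integral_of_dominated_convergence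
    (fun n _ => |coeff n f * x ^ n|)
    (fun n => (by fun_prop : Continuous fun t : ℝ => coeff n f * t ^ n).aestronglyMeasurable)
    (fun n => Eventually.of_forall fun t ht => ?_)
    (Eventually.of_forall fun _ _ => (h x hx).summable.abs) intervalIntegrable_const
    (Eventually.of_forall fun t ht => ?_) <;> rw [Set.uIoc_of_le hx.1.le] at ht
  · rw [Real.norm_eq_abs, abs_mul, abs_mul, abs_pow, abs_pow, abs_of_pos ht.1, abs_of_pos hx.1]
    gcongr
    exacts [ht.1.le, ht.2]
  · exact h t ⟨ht.1, ht.2.trans_lt hx.2⟩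

theorem HasValue.shift {f : PowerSeries ℝ} {F : ℝ → ℝ} (h : HasValue f F)
    (hf : constantCoeff f = 0) :
    HasValue (PowerSeries.mk fun n => coeff (n + 1) f) fun x => 1 / x * F x := by
  intro x hx
  rw [← PowerSeries.coeff_zero_eq_constantCoeff_apply] at hf
  have hsucc := ((hasSum_nat_add_iff' 1).mpr (h x hx)).mul_left (1 / x)
  rw [Finset.sum_range_one, hf, zero_mul, sub_zero] at hsucc
  refine hsucc.congr_fun fun n => ?_
  have hx0 := hx.1.ne'
  rw [PowerSeries.coeff_mk, pow_succ]
  field_simp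

theorem hasValue_wordSeries {w : List (Option ℤˣ)} (hw : IsConvergent w) :
    HasValue (wordSeries w) (iterInt (w.map letterForm)) := by
  induction w with
  | nil =>
    intro x _
    have hterm (n : ℕ) (hn : n ≠ 0) : coeff n (wordSeries []) * x ^ n = 0 := by
      simp [wordSeries, PowerSeries.coeff_one, hn]
    simpa [wordSeries, iterInt] using hasSum_single 0 hterm
  | cons y w ih =>
    specialize ih hw.of_cons
    cases y with
    | none => exact (ih.shift hw.constantCoeff_wordSeries).integral
    | some a => exact ((hasValue_letterSeries a).mul ih).integral

theorem iterInt_singleton_mul (q : ℤˣ) {w : List (Option ℤˣ)} (hw : IsConvergent w) {x : ℝ}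
    (hx : x ∈ Set.Ioo (0 : ℝ) 1) :
    iterInt [letterForm (some q)] x * iterInt (w.map letterForm) x =
      ∑ i ∈ Finset.range (w.length + 1),
        iterInt ((w.insertIdx i (some q)).map letterForm) x := by
  have hletter : IsConvergent [some q] := by simp [IsConvergent]
  have hprod := (hasValue_wordSeries hletter).mul (hasValue_wordSeries hw)
  rw [wordSeries_singleton_mul q hw] at hprod
  exact hprod.unique (HasValue.sum fun i _ => hasValue_wordSeries (hw.insertIdx q i)) hx

/-! ### Asymptotics of truncated sums -/

/-- The scale `n ^ (-1/2)` in which error terms are measured, shifted to be positive at `0`. -/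
noncomputable def invSqrt (n : ℕ) : ℝ := 1 / √((n : ℝ) + 1)

theorem invSqrt_pos (n : ℕ) : 0 < invSqrt n := by
  unfold invSqrt
  positivity

theorem inv_sqrt_le_sub_sqrt (n : ℕ) :
    1 / √((n : ℝ) + 1) ≤ 2 * (√((n : ℝ) + 1) - √(n : ℝ)) := by
  have hsq : √((n : ℝ) + 1) ^ 2 = n + 1 := Real.sq_sqrt (by positivity)
  have hsq' : √(n : ℝ) ^ 2 = n := Real.sq_sqrt (by positivity)
  rw [div_le_iff₀ (by positivity)]
  nlinarith [sq_nonneg (√((n : ℝ) + 1) - √(n : ℝ))]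

theorem invSqrt_div_le_sub (n : ℕ) :
    invSqrt n / ((n : ℝ) + 1) ≤ 4 * (invSqrt n - invSqrt (n + 1)) := by
  have hsqrt := inv_sqrt_le_sub_sqrt (n + 1)
  have hsq : √((n : ℝ) + 1) ^ 2 = n + 1 := Real.sq_sqrt (by positivity)
  have hsq' : √((n : ℝ) + 1 + 1) ^ 2 = n + 1 + 1 := Real.sq_sqrt (by positivity)
  unfold invSqrt
  push_cast at hsqrt ⊢
  have hr : 0 < √((n : ℝ) + 1) := by positivity
  have ht : 0 < √((n : ℝ) + 1 + 1) := by positivity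
  set r := √((n : ℝ) + 1)
  set t := √((n : ℝ) + 1 + 1)
  calc 1 / r / ((n : ℝ) + 1) ≤ 1 / r * (2 / t ^ 2) := by
        rw [hsq', div_eq_mul_one_div]
        gcongr 1 / r * ?_
        rw [div_le_div_iff₀ (by positivity) (by positivity)]
        linarith [(Nat.cast_nonneg n : (0 : ℝ) ≤ n)]
    _ = 2 / (r * t) * (1 / t) := by ring
    _ ≤ 2 / (r * t) * (2 * (t - r)) := by gcongr
    _ = 4 * (1 / r - 1 / t) := by
        field_simp
        ring

theorem exists_forall_abs_sub_le {a b : ℕ → ℝ} (hb : ∀ n, 0 ≤ b n)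
    (h : ∀ n, |a (n + 1) - a n| ≤ b n - b (n + 1)) : ∃ L, ∀ n, |a n - L| ≤ b n := by
  have hlower : Monotone fun n => a n - b n :=
    monotone_nat_of_le_succ fun n => by linarith [neg_abs_le (a (n + 1) - a n), h n]
  have hupper : Antitone fun n => a n + b n :=
    antitone_nat_of_succ_le fun n => by linarith [le_abs_self (a (n + 1) - a n), h n]
  have hmem := hlower.ciSup_mem_iInter_Icc_of_antitone hupper fun n => by linarith [hb n]
  refine ⟨⨆ n, a n - b n, fun n => ?_⟩
  obtain ⟨hle, hge⟩ := Set.mem_iInter.mp hmem n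
  exact abs_sub_le_iff.mpr ⟨by linarith, by linarith⟩

theorem exists_isBigO_sub_const {a : ℕ → ℝ}
    (h : (fun n => a (n + 1) - a n) =O[atTop] fun n => invSqrt n / ((n : ℝ) + 1)) :
    ∃ L, (fun n => a n - L) =O[atTop] invSqrt := by
  have hscale (n : ℕ) : 0 < invSqrt n / ((n : ℝ) + 1) := div_pos (invSqrt_pos n) (by positivity)
  obtain ⟨K, hK, hbound⟩ := bound_of_isBigO_nat_atTop h
  have hstep (n : ℕ) : |a (n + 1) - a n| ≤ 4 * K * invSqrt n - 4 * K * invSqrt (n + 1) :=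
    calc |a (n + 1) - a n| ≤ K * (invSqrt n / ((n : ℝ) + 1)) := by
          have h := hbound (hscale n).ne'
          rwa [Real.norm_of_nonneg (hscale n).le] at h
      _ ≤ K * (4 * (invSqrt n - invSqrt (n + 1))) := by
          gcongr
          exact invSqrt_div_le_sub n
      _ = 4 * K * invSqrt n - 4 * K * invSqrt (n + 1) := by ring
  obtain ⟨L, hL⟩ := exists_forall_abs_sub_le
    (fun n => mul_nonneg (by positivity) (invSqrt_pos n).le) hstep
  exact ⟨L, .of_bound (4 * K) (Eventually.of_forall fun n => by
    simpa [abs_of_pos (invSqrt_pos n)] using hL n)⟩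

theorem isBigO_sqrt_of_isBigO_sub {a : ℕ → ℝ}
    (h : (fun n => a (n + 1) - a n) =O[atTop] invSqrt) :
    a =O[atTop] fun n => √((n : ℝ) + 1) := by
  obtain ⟨K, hK, hbound⟩ := bound_of_isBigO_nat_atTop h
  have hgrowth (n : ℕ) : |a n| ≤ |a 0| + 2 * K * √(n : ℝ) := by
    induction n with
    | zero => simp
    | succ n ih =>
      have hstep : |a (n + 1) - a n| ≤ K * invSqrt n := by
        simpa [abs_of_pos (invSqrt_pos n)] using hbound (invSqrt_pos n).ne'
      have hsqrt := mul_le_mul_of_nonneg_left (inv_sqrt_le_sub_sqrt n) hK.le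
      have htriangle := abs_sub_abs_le_abs_sub (a (n + 1)) (a n)
      rw [invSqrt] at hstep
      push_cast
      linarith
  refine .of_bound (|a 0| + 2 * K) (Eventually.of_forall fun n => (hgrowth n).trans ?_)
  have hone : 1 ≤ √((n : ℝ) + 1) := Real.one_le_sqrt.mpr (by simp)
  have hmono : √(n : ℝ) ≤ √((n : ℝ) + 1) := Real.sqrt_le_sqrt (by simp)
  rw [Real.norm_of_nonneg (Real.sqrt_nonneg _), add_mul]
  gcongr
  exact le_mul_of_one_le_right (abs_nonneg _) hone

theorem sqrt_div_self_eq_invSqrt (n : ℕ) : √((n : ℝ) + 1) / ((n : ℝ) + 1) = invSqrt n :=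
  Real.sqrt_div_self'

theorem isBigO_truncSum_sub {s t : ℕ} (hts : t + 1 ≤ s) (z : ℤˣ) {l : List Entry}
    (hl : truncSum l =O[atTop] fun n => √((n : ℝ) + 1)) :
    (fun n => truncSum ((s, z) :: l) (n + 1) - truncSum ((s, z) :: l) n) =O[atTop]
      fun n => invSqrt n / ((n : ℝ) + 1) ^ t := by
  have hcoeff : (fun n : ℕ => ((z : ℤ) : ℝ) ^ (n + 1) / ((n : ℝ) + 1) ^ s) =O[atTop]
      fun n => 1 / ((n : ℝ) + 1) ^ (t + 1) := by
    refine .of_bound' (Eventually.of_forall fun n => ?_)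
    rw [norm_div, norm_pow, Real.norm_eq_abs, abs_cast_units, one_pow, norm_div, norm_one,
      norm_pow, norm_pow, Real.norm_of_nonneg (by positivity)]
    gcongr
    simp
  refine (hcoeff.mul hl).congr (fun n => ?_) fun n => ?_
  · rw [truncSum_cons_succ, add_sub_cancel_left]
  · rw [← sqrt_div_self_eq_invSqrt, pow_succ']
    field_simp

theorem isBigO_truncSum_sqrt {l : List Entry} (hl : IsIndex l) :
    truncSum l =O[atTop] fun n => √((n : ℝ) + 1) := by
  induction l with
  | nil => exact isBigO_sqrt_of_isBigO_sub (by simpa [truncSum] using isBigO_zero _ _)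
  | cons e l ih =>
    refine isBigO_sqrt_of_isBigO_sub ?_
    simpa using isBigO_truncSum_sub (hl e List.mem_cons_self) e.2 (ih hl.of_cons)

theorem isBigO_truncSum_div {l : List Entry} (hl : IsIndex l) :
    (fun n => truncSum l n / ((n : ℝ) + 1)) =O[atTop] invSqrt := by
  refine ((isBigO_truncSum_sqrt hl).mul (isBigO_refl (fun n : ℕ => ((n : ℝ) + 1)⁻¹) _)).congr
    (fun n => rfl) fun n => ?_
  exact sqrt_div_self_eq_invSqrt n

theorem exists_isBigO_truncSum_sub_of_two_le {s : ℕ} (hs : 2 ≤ s) (z : ℤˣ) {l : List Entry}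
    (hl : IsIndex l) : ∃ L, (fun n => truncSum ((s, z) :: l) n - L) =O[atTop] invSqrt :=
  exists_isBigO_sub_const <| by
    simpa using isBigO_truncSum_sub hs z (isBigO_truncSum_sqrt hl)

theorem exists_isBigO_sub_of_alternating {a g : ℕ → ℝ}
    (ha : ∀ n, a (n + 1) = a n + (-1) ^ (n + 1) * g n) (hg : g =O[atTop] invSqrt)
    (hg' : (fun n => g (n + 1) - g n) =O[atTop] fun n => invSqrt n / ((n : ℝ) + 1)) :
    ∃ L, (fun n => a n - L) =O[atTop] invSqrt := by
  have hcorrection : (fun n => (-1) ^ n * g n / 2) =O[atTop] invSqrt :=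
    (isBigO_of_le _ fun n => by simp).trans hg
  -- Subtracting half of the last term averages consecutive partial sums.
  obtain ⟨L, hL⟩ := exists_isBigO_sub_const (a := fun n => a n - (-1) ^ n * g n / 2) <| by
    refine IsBigO.trans (isBigO_of_le _ fun n => ?_) hg'
    have hdiff : a (n + 1) - (-1) ^ (n + 1) * g (n + 1) / 2 - (a n - (-1) ^ n * g n / 2) =
        (-1) ^ n * ((g (n + 1) - g n) / 2) := by
      rw [ha]
      ring
    simp only [hdiff]
    simp
  exact ⟨L, (hL.add hcorrection).congr_left fun n => by ring⟩

theorem isBigO_truncSum_sub_invSqrt {l : List Entry} (hl : IsIndex l) :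
    (fun n => truncSum l (n + 1) - truncSum l n) =O[atTop] invSqrt := by
  cases l with
  | nil => simpa [truncSum] using isBigO_zero _ _
  | cons e l =>
    simpa using isBigO_truncSum_sub (hl e List.mem_cons_self) e.2 (isBigO_truncSum_sqrt hl.of_cons)

theorem isBigO_truncSum_div_sub {l : List Entry} (hl : IsIndex l) :
    (fun n : ℕ => truncSum l (n + 1) / (((n + 1 : ℕ) : ℝ) + 1) - truncSum l n / ((n : ℝ) + 1))
      =O[atTop] fun n => invSqrt n / ((n : ℝ) + 1) := by
  have hinv : (fun n : ℕ => 1 / ((n : ℝ) + 1 + 1)) =O[atTop] fun n => 1 / ((n : ℝ) + 1) := by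
    refine .of_bound' (Eventually.of_forall fun n => ?_)
    rw [Real.norm_of_nonneg (by positivity), Real.norm_of_nonneg (by positivity)]
    gcongr
    simp
  refine (((isBigO_truncSum_sub_invSqrt hl).sub (isBigO_truncSum_div hl)).mul hinv).congr
    (fun n => ?_) fun n => by rw [mul_one_div]
  push_cast
  field_simp
  ring

theorem exists_isBigO_truncSum_sub_of_bar_one {l : List Entry} (hl : IsIndex l) :
    ∃ L, (fun n => truncSum (bar 1 :: l) n - L) =O[atTop] invSqrt := by
  refine exists_isBigO_sub_of_alternating (g := fun n => truncSum l n / ((n : ℝ) + 1))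
    (fun n => ?_) (isBigO_truncSum_div hl) (isBigO_truncSum_div_sub hl)
  rw [bar, truncSum_cons_succ]
  push_cast
  ring

theorem exists_isBigO_truncSum_sub {l : List Entry} (hl : IsAdmissible l) :
    ∃ L, (fun n => truncSum l n - L) =O[atTop] invSqrt := by
  obtain ⟨hidx, hne, hhead⟩ := hl
  rcases l with _ | ⟨⟨s, z⟩, l⟩
  · exact absurd rfl hne
  · have hs : 1 ≤ s := hidx (s, z) List.mem_cons_self
    rcases hs.eq_or_lt with rfl | hs
    · rcases Int.units_eq_one_or z with rfl | rfl
      · exact absurd rfl hhead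
      · exact exists_isBigO_truncSum_sub_of_bar_one hidx.of_cons
    · exact exists_isBigO_truncSum_sub_of_two_le hs z hidx.of_cons

theorem tendsto_invSqrt : Tendsto invSqrt atTop (𝓝 0) :=
  (Real.tendsto_sqrt_atTop.comp
    (tendsto_atTop_add_const_right _ _ tendsto_natCast_atTop_atTop)).const_div_atTop 1

theorem tendsto_of_isBigO_sub {a : ℕ → ℝ} {L : ℝ} (h : (fun n => a n - L) =O[atTop] invSqrt) :
    Tendsto a atTop (𝓝 L) :=
  tendsto_sub_nhds_zero_iff.mp (h.trans_tendsto tendsto_invSqrt)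

theorem isBigO_truncSum_sub_eulerSum {l : List Entry} (hl : IsAdmissible l) :
    (fun n => truncSum l n - eulerSum l) =O[atTop] invSqrt := by
  obtain ⟨L, hL⟩ := exists_isBigO_truncSum_sub hl
  rwa [eulerSum, (tendsto_of_isBigO_sub hL).limUnder_eq]

theorem tendsto_truncSum {l : List Entry} (hl : IsAdmissible l) :
    Tendsto (truncSum l) atTop (𝓝 (eulerSum l)) :=
  tendsto_of_isBigO_sub (isBigO_truncSum_sub_eulerSum hl)

/-! ### Expansions in the sums `ζ^(M)(1, …, 1)` -/

/-- The truncated sums of the index `(1, …, 1)` of depth `k`. -/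
noncomputable def ones (k : ℕ) : ℕ → ℝ := truncSum (List.replicate k (pos 1))

/-- Up to the error `O(n ^ (-1/2))`, `a` is the linear combination of `ones 0, …, ones d` with
coefficients `c`. Since `ones k n` is a polynomial of degree `k` in `log n` up to a small error,
this describes how `a` diverges. -/
def HasExpansion (a : ℕ → ℝ) (d : ℕ) (c : ℕ → ℝ) : Prop :=
  (fun n => a n - ∑ k ∈ Finset.range (d + 1), c k * ones k n) =O[atTop] invSqrt

theorem truncSum_pos_one_cons_succ (l : List Entry) (n : ℕ) :
    truncSum (pos 1 :: l) (n + 1) = truncSum (pos 1 :: l) n + truncSum l n / ((n : ℝ) + 1) := by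
  rw [pos, truncSum_cons_succ]
  push_cast
  ring

theorem HasExpansion.pos_one_cons {l : List Entry} {d : ℕ} {c : ℕ → ℝ}
    (h : HasExpansion (truncSum l) d c) :
    ∃ c' : ℕ → ℝ, (∀ k, c' (k + 1) = c k) ∧
      HasExpansion (truncSum (pos 1 :: l)) (d + 1) c' := by
  obtain ⟨L, hL⟩ := exists_isBigO_sub_const
    (a := fun n => truncSum (pos 1 :: l) n - ∑ k ∈ Finset.range (d + 1), c k * ones (k + 1) n) <| by
      refine (h.mul (isBigO_refl (fun n : ℕ => ((n : ℝ) + 1)⁻¹) _)).congr_left fun n => ?_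
      have hstep (k : ℕ) : ones (k + 1) (n + 1) = ones (k + 1) n + ones k n / ((n : ℝ) + 1) :=
        truncSum_pos_one_cons_succ _ n
      simp only [truncSum_pos_one_cons_succ, hstep, mul_add, Finset.sum_add_distrib,
        ← mul_div_assoc, ← Finset.sum_div]
      ring
  refine ⟨fun k => Nat.casesOn k L c, fun k => rfl, hL.congr_left fun n => ?_⟩
  simp [Finset.sum_range_succ' _ (d + 1), ones, truncSum, sub_sub]

theorem exists_hasExpansion_replicate_append {m : List Entry}
    (hm : (fun n => truncSum m n - eulerSum m) =O[atTop] invSqrt) (i : ℕ) :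
    ∃ c : ℕ → ℝ, c i = eulerSum m ∧
      HasExpansion (truncSum (List.replicate i (pos 1) ++ m)) i c := by
  induction i with
  | zero => exact ⟨fun _ => eulerSum m, rfl, by simpa [HasExpansion, ones, truncSum] using hm⟩
  | succ i ih =>
    obtain ⟨c, hci, hc⟩ := ih
    obtain ⟨c', hcc', hc'⟩ := hc.pos_one_cons
    exact ⟨c', (hcc' i).trans hci, hc'⟩

theorem IsIndex.exists_eq_replicate_append {l : List Entry} (hl : IsIndex l) :
    ∃ i m, l = List.replicate i (pos 1) ++ m ∧ (m = [] ∨ IsAdmissible m) := by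
  induction l with
  | nil => exact ⟨0, [], rfl, .inl rfl⟩
  | cons e l ih =>
    by_cases he : e = pos 1
    · obtain ⟨i, m, rfl, hm⟩ := ih hl.of_cons
      exact ⟨i + 1, m, by rw [he]; rfl, hm⟩
    · exact ⟨0, e :: l, rfl, .inr ⟨hl, by simp, by simpa using he⟩⟩

theorem eulerSum_nil : eulerSum [] = 1 :=
  tendsto_const_nhds.limUnder_eq

theorem isBigO_truncSum_nil_sub : (fun n => truncSum [] n - eulerSum []) =O[atTop] invSqrt := by
  simpa [eulerSum_nil, truncSum] using isBigO_zero _ _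

theorem exists_hasExpansion {l : List Entry} (hl : IsIndex l) :
    ∃ d c, HasExpansion (truncSum l) d c := by
  obtain ⟨i, m, rfl, rfl | hm⟩ := hl.exists_eq_replicate_append
  · obtain ⟨c, -, hc⟩ := exists_hasExpansion_replicate_append isBigO_truncSum_nil_sub i
    exact ⟨i, c, hc⟩
  · obtain ⟨c, -, hc⟩ :=
      exists_hasExpansion_replicate_append (isBigO_truncSum_sub_eulerSum hm) i
    exact ⟨i, c, hc⟩

/-! ### Regularization along a filter -/

/-- The function `a` agrees with `P(T)` up to an error smaller than every power of `T⁻¹`. Unlike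
agreement up to `o(1)`, this is compatible with products. -/
def HasRegularization {α : Type*} (F : Filter α) (T a : α → ℝ) (P : ℝ[X]) : Prop :=
  SuperpolynomialDecay F T fun i => a i - P.eval (T i)

section Regularization

variable {α : Type*} {F : Filter α} {T a b : α → ℝ} {P Q : ℝ[X]}

theorem HasRegularization.tendsto (h : HasRegularization F T a P) :
    Tendsto (fun i => a i - P.eval (T i)) F (𝓝 0) := by
  simpa using h 0

theorem HasRegularization.unique [F.NeBot] (hT : Tendsto T F atTop)
    (h : HasRegularization F T a P) (h' : HasRegularization F T a Q) : P = Q := by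
  refine sub_eq_zero.mp (eq_zero_of_tendsto hT ?_)
  simpa using h'.tendsto.sub h.tendsto

theorem HasRegularization.congr (h : HasRegularization F T a P) (hab : a =ᶠ[F] b) :
    HasRegularization F T b P :=
  SuperpolynomialDecay.congr' h (hab.mono fun i hi => by simp only [hi])

theorem hasRegularization_param : HasRegularization F T T X :=
  (superpolynomialDecay_zero F T).congr fun i => by simp

theorem hasRegularization_const (c : ℝ) : HasRegularization F T (fun _ => c) (C c) :=
  (superpolynomialDecay_zero F T).congr fun i => by simp

theorem HasRegularization.add (h : HasRegularization F T a P) (h' : HasRegularization F T b Q) :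
    HasRegularization F T (fun i => a i + b i) (P + Q) :=
  (SuperpolynomialDecay.add h h').congr fun i => by
    simp only [Pi.add_apply, eval_add]
    ring

theorem HasRegularization.mul (h : HasRegularization F T a P) (h' : HasRegularization F T b Q) :
    HasRegularization F T (fun i => a i * b i) (P * Q) :=
  (((SuperpolynomialDecay.mul h h').add (SuperpolynomialDecay.mul_polynomial h Q)).add
    (SuperpolynomialDecay.polynomial_mul h' P)).congr fun i => by
      simp only [Pi.add_apply, Pi.mul_apply, eval_mul]
      ring

theorem HasRegularization.const_mul (c : ℝ) (h : HasRegularization F T a P) :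
    HasRegularization F T (fun i => c * a i) (C c * P) :=
  (hasRegularization_const c).mul h

theorem HasRegularization.sub (h : HasRegularization F T a P) (h' : HasRegularization F T b Q) :
    HasRegularization F T (fun i => a i - b i) (P - Q) := by
  simpa [sub_eq_add_neg] using h.add (h'.const_mul (-1))

theorem HasRegularization.sum {ι : Type*} {s : Finset ι} {a : ι → α → ℝ} {P : ι → ℝ[X]}
    (h : ∀ j ∈ s, HasRegularization F T (a j) (P j)) :
    HasRegularization F T (fun i => ∑ j ∈ s, a j i) (∑ j ∈ s, P j) := by
  classical
  induction s using Finset.induction_on with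
  | empty => simpa using hasRegularization_const 0
  | insert j s hj ih =>
    simp only [Finset.sum_insert hj]
    exact (h j (Finset.mem_insert_self _ _)).add (ih fun i hi => h i (Finset.mem_insert_of_mem hi))

theorem HasRegularization.of_decay_sub (h : HasRegularization F T b P)
    (hab : SuperpolynomialDecay F T fun i => a i - b i) : HasRegularization F T a P :=
  (hab.add h).congr fun _ => sub_add_sub_cancel _ _ _

theorem superpolynomialDecay_exp_neg_mul (hT : Tendsto T F atTop) {δ : ℝ} (hδ : 0 < δ) :
    SuperpolynomialDecay F T fun i => Real.exp (-(δ * T i)) := by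
  intro k
  have hlim := ((Real.tendsto_pow_mul_exp_neg_atTop_nhds_zero k).comp
    (hT.const_mul_atTop hδ)).const_mul (δ ^ k)⁻¹
  rw [mul_zero] at hlim
  refine hlim.congr fun i => ?_
  rw [Function.comp_apply, mul_pow]
  field_simp

theorem superpolynomialDecay_of_isBigO {f g : α → ℝ} (hg : SuperpolynomialDecay F T g)
    (hf : f =O[F] g) : SuperpolynomialDecay F T f := by
  obtain ⟨K, hK⟩ := hf.bound
  refine (hg.const_mul K).trans_eventually_abs_le (hK.mono fun i hi => hi.trans ?_)
  rw [Function.comp_apply, abs_mul]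
  gcongr
  exacts [le_abs_self K, le_rfl]

end Regularization

/-! ### Stuffle regularization -/

/-- The variable `log M + γ` of the stuffle regularization. -/
noncomputable def stuffleVar (M : ℕ) : ℝ := Real.log M + Real.eulerMascheroniConstant

theorem tendsto_stuffleVar : Tendsto stuffleVar atTop atTop :=
  tendsto_atTop_add_const_right _ _ (Real.tendsto_log_atTop.comp tendsto_natCast_atTop_atTop)

theorem isBigO_invSqrt_exp_neg_stuffleVar :
    invSqrt =O[atTop] fun n => Real.exp (-(1 / 2 * stuffleVar n)) := by
  refine .of_bound (Real.exp (1 / 2 * Real.eulerMascheroniConstant)) ?_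
  filter_upwards [eventually_gt_atTop 0] with n hn
  have hn : (0 : ℝ) < n := by exact_mod_cast hn
  have hexp : Real.exp (1 / 2 * Real.eulerMascheroniConstant) *
      Real.exp (-(1 / 2 * stuffleVar n)) = 1 / √(n : ℝ) := by
    have hlog : 1 / 2 * Real.eulerMascheroniConstant + -(1 / 2 * stuffleVar n) = -Real.log √n := by
      rw [stuffleVar, Real.log_sqrt hn.le]
      ring
    rw [← Real.exp_add, hlog, Real.exp_neg, Real.exp_log (Real.sqrt_pos.mpr hn), one_div]
  rw [Real.norm_of_nonneg (invSqrt_pos n).le, Real.norm_of_nonneg (Real.exp_pos _).le, hexp,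
    invSqrt]
  gcongr
  linarith

theorem superpolynomialDecay_of_isBigO_invSqrt {a : ℕ → ℝ} (h : a =O[atTop] invSqrt) :
    SuperpolynomialDecay atTop stuffleVar a :=
  superpolynomialDecay_of_isBigO
    (superpolynomialDecay_exp_neg_mul tendsto_stuffleVar one_half_pos)
    (h.trans isBigO_invSqrt_exp_neg_stuffleVar)

theorem ones_one_eq_harmonic (n : ℕ) : ones 1 n = harmonic n := by
  simp [ones, truncSum, pos, harmonic_eq_sum_Icc]

theorem abs_ones_one_sub_stuffleVar_le {n : ℕ} (hn : n ≠ 0) :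
    |ones 1 n - stuffleVar n| ≤ 1 / n := by
  have hlower := Real.eulerMascheroniSeq_lt_eulerMascheroniConstant n
  have hupper := Real.eulerMascheroniConstant_lt_eulerMascheroniSeq' n
  rw [Real.eulerMascheroniSeq] at hlower
  rw [Real.eulerMascheroniSeq', if_neg hn] at hupper
  have hn : (0 : ℝ) < n := by exact_mod_cast hn.bot_lt
  have hlog : Real.log ((n : ℝ) + 1) - Real.log n ≤ 1 / n := by
    rw [← Real.log_div (by positivity) hn.ne']
    refine (Real.log_le_sub_one_of_pos (by positivity)).trans_eq ?_
    field_simp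
    ring
  have hpos : 0 < 1 / (n : ℝ) := one_div_pos.mpr hn
  rw [ones_one_eq_harmonic, stuffleVar, abs_le]
  constructor <;> linarith [hpos]

theorem one_div_le_two_mul_invSqrt {n : ℕ} (hn : n ≠ 0) : 1 / (n : ℝ) ≤ 2 * invSqrt n := by
  have hn : (1 : ℝ) ≤ n := by exact_mod_cast hn.bot_lt
  have hsqrt : √((n : ℝ) + 1) ≤ n + 1 := (Real.sqrt_le_left (by linarith)).mpr (by nlinarith)
  rw [invSqrt, mul_one_div, div_le_div_iff₀ (by linarith) (by positivity)]
  linarith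

theorem hasRegularization_ones_one : HasRegularization atTop stuffleVar (ones 1) X := by
  refine hasRegularization_param.of_decay_sub (superpolynomialDecay_of_isBigO_invSqrt ?_)
  refine .of_bound 2 ((eventually_ne_atTop 0).mono fun n hn => ?_)
  rw [Real.norm_of_nonneg (invSqrt_pos n).le]
  exact (abs_ones_one_sub_stuffleVar_le hn).trans (one_div_le_two_mul_invSqrt hn)

theorem hasRegularization_ones_zero : HasRegularization atTop stuffleVar (ones 0) 1 :=
  hasRegularization_const 1

theorem insertIdx_replicate_self {α : Type*} (a : α) {i k : ℕ} (hi : i ≤ k) :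
    (List.replicate k a).insertIdx i a = List.replicate (k + 1) a := by
  refine List.eq_replicate_iff.mpr
    ⟨by simp [List.length_insertIdx_of_le_length, hi], fun b hb => ?_⟩
  rcases List.eq_or_mem_of_mem_insertIdx hb with rfl | hb
  exacts [rfl, List.eq_of_mem_replicate hb]

theorem modify_replicate {α : Type*} (f : α → α) (a : α) {i k : ℕ} (hi : i < k) :
    (List.replicate k a).modify i f =
      List.replicate i a ++ f a :: List.replicate (k - (i + 1)) a := by
  rw [List.modify_eq_take_cons_drop (by simpa using hi)]
  simp [hi.le]

theorem ones_one_mul_ones (k n : ℕ) :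
    ones 1 n * ones k n = (k + 1) * ones (k + 1) n + ∑ i ∈ Finset.range k,
      truncSum (List.replicate i (pos 1) ++ pos 2 :: List.replicate (k - (i + 1)) (pos 1)) n := by
  have hproduct := truncSum_singleton_mul (pos 1) (List.replicate k (pos 1)) n
  rw [List.length_replicate] at hproduct
  refine hproduct.trans (congrArg₂ _ ?_ (Finset.sum_congr rfl fun i hi => ?_))
  · rw [Finset.sum_congr rfl fun i hi => by
      rw [insertIdx_replicate_self _ (Finset.mem_range_succ_iff.mp hi)]]
    simp [ones]
  · rw [modify_replicate _ _ (Finset.mem_range.mp hi)]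
    rfl

theorem HasExpansion.hasRegularization {a : ℕ → ℝ} {d : ℕ} {c : ℕ → ℝ} {P : ℕ → ℝ[X]}
    (h : HasExpansion a d c)
    (hP : ∀ k ≤ d, HasRegularization atTop stuffleVar (ones k) (P k)) :
    HasRegularization atTop stuffleVar a (∑ k ∈ Finset.range (d + 1), C (c k) * P k) :=
  HasRegularization.of_decay_sub
    (.sum fun k hk => (hP k (Finset.mem_range_succ_iff.mp hk)).const_mul (c k))
    (superpolynomialDecay_of_isBigO_invSqrt h)

theorem isIndex_replicate_pos_one (k : ℕ) : IsIndex (List.replicate k (pos 1)) := fun e he => by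
  rw [List.eq_of_mem_replicate he, pos]

theorem isAdmissible_cons_of_two_le {s : ℕ} (hs : 2 ≤ s) (z : ℤˣ) {l : List Entry}
    (hl : IsIndex l) : IsAdmissible ((s, z) :: l) :=
  ⟨List.forall_mem_cons.mpr ⟨by lia, hl⟩, by simp, by simp [pos]; lia⟩

theorem exists_hasRegularization_ones (k : ℕ) :
    ∃ P, HasRegularization atTop stuffleVar (ones k) P := by
  induction k using Nat.strong_induction_on with
  | _ k ih =>
    rcases k with _ | k
    · exact ⟨1, hasRegularization_ones_zero⟩
    have hmerged (i : ℕ) (hi : i < k) : ∃ P, HasRegularization atTop stuffleVar (truncSum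
        (List.replicate i (pos 1) ++ pos 2 :: List.replicate (k - (i + 1)) (pos 1))) P := by
      obtain ⟨c, -, hc⟩ := exists_hasExpansion_replicate_append (isBigO_truncSum_sub_eulerSum
        (isAdmissible_cons_of_two_le le_rfl 1 (isIndex_replicate_pos_one (k - (i + 1))))) i
      choose! P hP using ih
      exact ⟨_, hc.hasRegularization fun j hj => hP j (by lia)⟩
    choose! Q hQ using hmerged
    obtain ⟨P, hP⟩ := ih k k.lt_succ_self
    have hproduct := (hasRegularization_ones_one.mul hP).sub
      (.sum fun i hi => hQ i (Finset.mem_range.mp hi))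
    refine ⟨_, (hproduct.const_mul (1 / (k + 1))).congr (Eventually.of_forall fun n => ?_)⟩
    dsimp only
    rw [ones_one_mul_ones, add_sub_cancel_right]
    field_simp

theorem zetaStar_eq {l : List Entry} {P : ℝ[X]}
    (h : HasRegularization atTop stuffleVar (truncSum l) P) : zetaStar l = P := by
  have hreg : ∃ P, IsStuffleReg l P := ⟨P, h.tendsto⟩
  rw [zetaStar, dif_pos hreg]
  exact hreg.choose_spec.unique h.tendsto

theorem hasRegularization_ones (k : ℕ) :
    HasRegularization atTop stuffleVar (ones k) (zetaStar (List.replicate k (pos 1))) := by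
  obtain ⟨P, hP⟩ := exists_hasRegularization_ones k
  rwa [zetaStar_eq hP]

theorem HasExpansion.zetaStar_eq {l : List Entry} {d : ℕ} {c : ℕ → ℝ}
    (h : HasExpansion (truncSum l) d c) : zetaStar l =
      ∑ k ∈ Finset.range (d + 1), C (c k) * zetaStar (List.replicate k (pos 1)) :=
  EulerSums.zetaStar_eq (h.hasRegularization fun k _ => hasRegularization_ones k)

theorem hasRegularization_truncSum {l : List Entry} (hl : IsIndex l) :
    HasRegularization atTop stuffleVar (truncSum l) (zetaStar l) := by
  obtain ⟨d, c, h⟩ := exists_hasExpansion hl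
  rw [h.zetaStar_eq]
  exact h.hasRegularization fun k _ => hasRegularization_ones k

theorem IsIndex.insertIdx {e : Entry} {l : List Entry} (hl : IsIndex l) (he : 1 ≤ e.1) (i : ℕ) :
    IsIndex (l.insertIdx i e) := fun f hf => by
  rcases List.eq_or_mem_of_mem_insertIdx hf with rfl | hf
  exacts [he, hl f hf]

theorem IsIndex.modify_merge {l : List Entry} (hl : IsIndex l) (e : Entry) (i : ℕ) :
    IsIndex (l.modify i (merge e)) := fun f hf => by
  obtain ⟨j, hj, rfl⟩ := List.mem_iff_getElem.mp hf
  rw [List.getElem_modify]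
  split_ifs
  exacts [Nat.le_add_left_of_le (hl _ (List.getElem_mem _)), hl _ (List.getElem_mem _)]

theorem zetaStar_singleton_mul {e : Entry} (he : 1 ≤ e.1) {l : List Entry} (hl : IsIndex l) :
    zetaStar [e] * zetaStar l =
      ∑ i ∈ Finset.range (l.length + 1), zetaStar (l.insertIdx i e) +
        ∑ i ∈ Finset.range l.length, zetaStar (l.modify i (merge e)) := by
  refine HasRegularization.unique tendsto_stuffleVar
    ((hasRegularization_truncSum (List.forall_mem_singleton.mpr he)).mul
      (hasRegularization_truncSum hl))
    (((HasRegularization.sum fun i _ => hasRegularization_truncSum (hl.insertIdx he i)).add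
      (.sum fun i _ => hasRegularization_truncSum (hl.modify_merge e i))).congr
        (Eventually.of_forall fun n => (truncSum_singleton_mul e l n).symm))

/-! ### Shuffle regularization -/

/-- The variable `-log ε` of the shuffle regularization. -/
noncomputable def shuffleVar (ε : ℝ) : ℝ := -Real.log ε

theorem tendsto_shuffleVar : Tendsto shuffleVar (𝓝[>] 0) atTop :=
  tendsto_neg_atBot_atTop.comp Real.tendsto_log_nhdsGT_zero

theorem exp_neg_half_mul_shuffleVar {ε : ℝ} (hε : 0 < ε) :
    Real.exp (-(1 / 2 * shuffleVar ε)) = √ε := by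
  have hlog : -(1 / 2 * shuffleVar ε) = Real.log √ε := by
    rw [shuffleVar, Real.log_sqrt hε.le]
    ring
  rw [hlog, Real.exp_log (Real.sqrt_pos.mpr hε)]

theorem word_replicate_pos_one (k : ℕ) :
    word 1 (List.replicate k (pos 1)) = List.replicate k (some 1) := by
  induction k with
  | zero => rfl
  | succ k ih => simpa [List.replicate_succ, word, pos] using ih

theorem truncInt_pos_one {ε : ℝ} (hε : 0 < ε) : truncInt [pos 1] ε = shuffleVar ε := by
  have hint : ∫ t in (0 : ℝ)..1 - ε, 1 / (1 - t) = Real.log (1 / ε) := by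
    rw [intervalIntegral.integral_comp_sub_left (fun t => 1 / t), sub_sub_cancel, sub_zero,
      integral_one_div_of_pos hε one_pos]
  simpa [truncInt, forms, pos, iterInt, shuffleVar] using hint

theorem truncInt_singleton_mul (q : ℤˣ) (l : List Entry) {ε : ℝ} (hε : ε ∈ Set.Ioo (0 : ℝ) 1) :
    truncInt [(1, q)] ε * truncInt l ε = ∑ i ∈ Finset.range ((word 1 l).length + 1),
      iterInt (((word 1 l).insertIdx i (some q)).map letterForm) (1 - ε) := by
  simpa [truncInt, forms_eq_map_word, word] using
    iterInt_singleton_mul q (isConvergent_word 1 l) (Set.Ioo.one_sub_mem hε)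

theorem truncInt_pos_one_mul_replicate (k : ℕ) {ε : ℝ} (hε : ε ∈ Set.Ioo (0 : ℝ) 1) :
    truncInt [pos 1] ε * truncInt (List.replicate k (pos 1)) ε =
      (k + 1) * truncInt (List.replicate (k + 1) (pos 1)) ε := by
  rw [pos, truncInt_singleton_mul 1 _ hε, ← pos, word_replicate_pos_one, List.length_replicate,
    Finset.sum_congr rfl fun i hi => by
      rw [insertIdx_replicate_self _ (Finset.mem_range_succ_iff.mp hi)]]
  simp [truncInt, forms_eq_map_word, word_replicate_pos_one]

theorem truncInt_replicate_pos_one (k : ℕ) {ε : ℝ} (hε : ε ∈ Set.Ioo (0 : ℝ) 1) :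
    truncInt (List.replicate k (pos 1)) ε = shuffleVar ε ^ k / k.factorial := by
  induction k with
  | zero => simp [truncInt, forms, iterInt]
  | succ k ih =>
    have hproduct := truncInt_pos_one_mul_replicate k hε
    rw [ih, truncInt_pos_one hε.1] at hproduct
    rw [Nat.factorial_succ]
    push_cast
    field_simp at hproduct ⊢
    linear_combination -hproduct

theorem invSqrt_mul_pow_le {ε : ℝ} (hε : ε ∈ Set.Ioc (0 : ℝ) (1 / 2)) (n : ℕ) :
    invSqrt n * (1 - ε) ^ n ≤
      √ε / 2 * (1 - ε) ^ n + 1 / √ε * ((1 - ε) ^ (n + 1) / ((n : ℝ) + 1)) := by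
  have hsq : invSqrt n ^ 2 = 1 / ((n : ℝ) + 1) := by
    rw [invSqrt, div_pow, one_pow, Real.sq_sqrt (by positivity)]
  have hε' : 0 < √ε := Real.sqrt_pos.mpr hε.1
  have hx : 1 / 2 ≤ 1 - ε := by linarith [hε.2]
  have hamgm : invSqrt n ≤ √ε / 2 + 1 / √ε * (invSqrt n ^ 2 / 2) := by
    have := two_mul_le_add_sq (√ε) (invSqrt n)
    field_simp
    linarith
  calc invSqrt n * (1 - ε) ^ n
      ≤ (√ε / 2 + 1 / √ε * (invSqrt n ^ 2 / 2)) * (1 - ε) ^ n := by gcongr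
    _ = √ε / 2 * (1 - ε) ^ n + 1 / √ε * ((1 - ε) ^ n * (1 / 2) / ((n : ℝ) + 1)) := by
        rw [hsq]; ring
    _ ≤ √ε / 2 * (1 - ε) ^ n + 1 / √ε * ((1 - ε) ^ n * (1 - ε) / ((n : ℝ) + 1)) := by
        gcongr
    _ = _ := by rw [pow_succ]

theorem abs_le_of_hasSum_of_abs_le_invSqrt {a : ℕ → ℝ} {K : ℝ} (ha : ∀ n, |a n| ≤ K * invSqrt n)
    {ε S : ℝ} (hε : ε ∈ Set.Ioc (0 : ℝ) (1 / 2)) (hS : HasSum (fun n => a n * (1 - ε) ^ n) S) :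
    |S| ≤ K * ((1 / 2 + shuffleVar ε) / √ε) := by
  have hx : 0 < 1 - ε := by linarith [hε.2]
  have hK : 0 ≤ K := nonneg_of_mul_nonneg_left ((abs_nonneg _).trans (ha 0)) (invSqrt_pos 0)
  have hgeometric : HasSum (fun n : ℕ => (1 - ε) ^ n) ε⁻¹ := by
    simpa using hasSum_geometric_of_lt_one hx.le (by linarith [hε.1])
  have hlog : HasSum (fun n : ℕ => (1 - ε) ^ (n + 1) / ((n : ℝ) + 1)) (shuffleVar ε) := by
    simpa [shuffleVar] using Real.hasSum_pow_div_log_of_abs_lt_one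
      (x := 1 - ε) (by rw [abs_of_pos hx]; linarith [hε.1])
  have hmajorant := ((hgeometric.mul_left (√ε / 2)).add (hlog.mul_left (1 / √ε))).mul_left K
  have hvalue : √ε / 2 * ε⁻¹ + 1 / √ε * shuffleVar ε = (1 / 2 + shuffleVar ε) / √ε := by
    have hε' : 0 < √ε := Real.sqrt_pos.mpr hε.1
    nth_rw 2 [← Real.sq_sqrt hε.1.le]
    field_simp
  rw [hvalue] at hmajorant
  rw [← hS.tsum_eq]
  refine tsum_of_norm_bounded (E := ℝ) hmajorant fun n => ?_
  rw [Real.norm_eq_abs, abs_mul, abs_of_pos (pow_pos hx n)]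
  calc |a n| * (1 - ε) ^ n ≤ K * invSqrt n * (1 - ε) ^ n := by gcongr; exact ha n
    _ ≤ _ := by
        rw [mul_assoc]
        gcongr
        exact invSqrt_mul_pow_le hε n

-- Abel summation: `f(x) / (1 - x)` is the generating function of the partial sums of `f`.
theorem superpolynomialDecay_of_isBigO_coeff {f : PowerSeries ℝ} {F : ℝ → ℝ} (hf : HasValue f F)
    (h : (fun n => coeff n (letterSeries 1 * f)) =O[atTop] invSqrt) :
    SuperpolynomialDecay (𝓝[>] 0) shuffleVar fun ε => F (1 - ε) := by
  obtain ⟨K, -, hK⟩ := bound_of_isBigO_nat_atTop h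
  have hbound (n : ℕ) : |coeff n (letterSeries 1 * f)| ≤ K * invSqrt n := by
    simpa [abs_of_pos (invSqrt_pos n)] using hK (invSqrt_pos n).ne'
  have hdecay := ((superpolynomialDecay_exp_neg_mul tendsto_shuffleVar one_half_pos).polynomial_mul
    (C (1 / 2) + X)).const_mul K
  refine hdecay.trans_eventually_abs_le ?_
  filter_upwards [Ioc_mem_nhdsGT (one_half_pos (α := ℝ))] with ε hε
  have hx : 1 - ε ∈ Set.Ioo (0 : ℝ) 1 := ⟨by linarith [hε.2], by linarith [hε.1]⟩
  have hpartial := abs_le_of_hasSum_of_abs_le_invSqrt hbound hε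
    (((hasValue_letterSeries 1).mul hf) _ hx)
  have hvalue : K * ((1 / 2 + shuffleVar ε) / √ε) * ε = K * ((1 / 2 + shuffleVar ε) * √ε) := by
    rw [mul_assoc, div_mul_eq_mul_div, mul_div_assoc, Real.div_sqrt]
  have hform : letterForm (some 1) (1 - ε) * F (1 - ε) = F (1 - ε) / ε := by
    simp [letterForm, div_eq_inv_mul]
  dsimp only at hpartial
  rw [hform, abs_div, abs_of_pos hε.1, div_le_iff₀ hε.1, hvalue] at hpartial
  simp only [Function.comp_apply, exp_neg_half_mul_shuffleVar hε.1, eval_add, eval_C, eval_X]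
  exact hpartial.trans (le_abs_self _)

theorem hasValue_wordSeries_word (l : List Entry) :
    HasValue (wordSeries (word 1 l)) (iterInt (forms 1 l)) := by
  rw [forms_eq_map_word]
  exact hasValue_wordSeries (isConvergent_word 1 l)

theorem coeff_letterSeries_one_mul_wordSeries_word {l : List Entry} (hl : IsIndex l) (n : ℕ) :
    coeff n (letterSeries 1 * wordSeries (word 1 l)) = truncSum l n := by
  simpa using coeff_letterSeries_mul_wordSeries_word 1 hl n

theorem HasExpansion.superpolynomialDecay_truncInt_sub {l : List Entry} (hl : IsIndex l) {d : ℕ}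
    {c : ℕ → ℝ} (h : HasExpansion (truncSum l) d c) :
    SuperpolynomialDecay (𝓝[>] 0) shuffleVar fun ε => truncInt l ε -
      ∑ k ∈ Finset.range (d + 1), c k * truncInt (List.replicate k (pos 1)) ε := by
  refine superpolynomialDecay_of_isBigO_coeff ((hasValue_wordSeries_word l).sub
    (.sum fun k _ => (hasValue_wordSeries_word (List.replicate k (pos 1))).smul (c k)))
    (h.congr_left fun n => ?_)
  simp only [mul_sub, Finset.mul_sum, mul_smul_comm, map_sub, map_sum, map_smul, smul_eq_mul,
    coeff_letterSeries_one_mul_wordSeries_word hl,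
    coeff_letterSeries_one_mul_wordSeries_word (isIndex_replicate_pos_one _), ones]

theorem hasRegularization_truncInt_replicate_pos_one (k : ℕ) :
    HasRegularization (𝓝[>] 0) shuffleVar (truncInt (List.replicate k (pos 1)))
      (C (1 / (k.factorial : ℝ)) * X ^ k) := by
  refine (superpolynomialDecay_zero _ _).congr' ?_
  filter_upwards [Ioo_mem_nhdsGT (one_pos : (0 : ℝ) < 1)] with ε hε
  simp [truncInt_replicate_pos_one k hε, div_eq_inv_mul]

theorem HasExpansion.hasRegularization_truncInt {l : List Entry} (hl : IsIndex l) {d : ℕ}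
    {c : ℕ → ℝ} (h : HasExpansion (truncSum l) d c) :
    HasRegularization (𝓝[>] 0) shuffleVar (truncInt l)
      (∑ k ∈ Finset.range (d + 1), C (c k) * (C (1 / (k.factorial : ℝ)) * X ^ k)) :=
  HasRegularization.of_decay_sub
    (.sum fun k _ => (hasRegularization_truncInt_replicate_pos_one k).const_mul (c k))
    (h.superpolynomialDecay_truncInt_sub hl)

theorem zetaSha_eq {l : List Entry} {P : ℝ[X]}
    (h : HasRegularization (𝓝[>] 0) shuffleVar (truncInt l) P) : zetaSha l = P := by
  have hreg : ∃ P, IsShuffleReg l P := ⟨P, h.tendsto⟩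
  rw [zetaSha, dif_pos hreg]
  exact hreg.choose_spec.unique h.tendsto

theorem hasRegularization_truncInt {l : List Entry} (hl : IsIndex l) :
    HasRegularization (𝓝[>] 0) shuffleVar (truncInt l) (zetaSha l) := by
  obtain ⟨d, c, h⟩ := exists_hasExpansion hl
  have hreg := h.hasRegularization_truncInt hl
  rwa [zetaSha_eq hreg]

/-! ### Comparison of the two regularizations -/

theorem zetaStar_eq_C_eulerSum {l : List Entry} (hl : IsAdmissible l) :
    zetaStar l = C (eulerSum l) :=
  zetaStar_eq <| (hasRegularization_const (eulerSum l)).of_decay_sub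
    (superpolynomialDecay_of_isBigO_invSqrt (isBigO_truncSum_sub_eulerSum hl))

theorem zetaStar_nil : zetaStar [] = 1 :=
  zetaStar_eq hasRegularization_ones_zero

theorem zetaStar_singleton_pos_one : zetaStar [pos 1] = X :=
  zetaStar_eq hasRegularization_ones_one

theorem zetaStar_pos_one_pos_one :
    zetaStar [pos 1, pos 1] = C (1 / 2) * (X ^ 2 - C (eulerSum [pos 2])) := by
  have hproduct : X ^ 2 = 2 * zetaStar [pos 1, pos 1] + C (eulerSum [pos 2]) := by
    have hindex : IsIndex [pos 1] := isIndex_replicate_pos_one 1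
    have hmerge : merge (pos 1) (pos 1) = pos 2 := rfl
    have htwo : IsAdmissible [pos 2] :=
      isAdmissible_cons_of_two_le le_rfl 1 (isIndex_replicate_pos_one 0)
    have hstuffle := zetaStar_singleton_mul (e := pos 1) le_rfl hindex
    simp only [List.length_singleton, Finset.sum_range_succ, Finset.sum_range_zero] at hstuffle
    simpa [hmerge, zetaStar_singleton_pos_one, zetaStar_eq_C_eulerSum htwo,
      ← two_mul, ← sq] using hstuffle
  have hhalf : C (1 / 2 : ℝ) * 2 = 1 := by
    rw [← C_ofNat, ← C_mul]
    norm_num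
  linear_combination -C (1 / 2) * hproduct - zetaStar [pos 1, pos 1] * hhalf

theorem zetaSha_replicate_pos_one (k : ℕ) :
    zetaSha (List.replicate k (pos 1)) = C (1 / (k.factorial : ℝ)) * X ^ k :=
  zetaSha_eq (hasRegularization_truncInt_replicate_pos_one k)

theorem HasExpansion.zetaSha_sub_zetaStar {l : List Entry} (hl : IsIndex l) {d : ℕ} {c : ℕ → ℝ}
    (h : HasExpansion (truncSum l) d c) :
    zetaSha l - zetaStar l = ∑ k ∈ Finset.range (d + 1), C (c k) *
      (zetaSha (List.replicate k (pos 1)) - zetaStar (List.replicate k (pos 1))) := by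
  simp only [zetaSha_eq (h.hasRegularization_truncInt hl), h.zetaStar_eq,
    zetaSha_replicate_pos_one, mul_sub, Finset.sum_sub_distrib]

theorem zetaSha_nil : zetaSha [] = 1 := by
  simpa using zetaSha_replicate_pos_one 0

theorem zetaSha_singleton_pos_one : zetaSha [pos 1] = X := by
  simpa using zetaSha_replicate_pos_one 1

theorem zetaSha_pos_one_pos_one : zetaSha [pos 1, pos 1] = C (1 / 2) * X ^ 2 := by
  simpa using zetaSha_replicate_pos_one 2

theorem zetaSha_eq_zetaStar_of_isAdmissible {l : List Entry} (hl : IsAdmissible l) :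
    zetaSha l = zetaStar l := by
  obtain ⟨c, -, hc⟩ := exists_hasExpansion_replicate_append (isBigO_truncSum_sub_eulerSum hl) 0
  simpa [zetaStar_nil, zetaSha_nil, sub_eq_zero] using hc.zetaSha_sub_zetaStar hl.1

theorem zetaSha_eq_C_eulerSum {l : List Entry} (hl : IsAdmissible l) :
    zetaSha l = C (eulerSum l) := by
  rw [zetaSha_eq_zetaStar_of_isAdmissible hl, zetaStar_eq_C_eulerSum hl]

theorem isAdmissible_bar_cons {s : ℕ} (hs : 1 ≤ s) {l : List Entry} (hl : IsIndex l) :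
    IsAdmissible (bar s :: l) :=
  ⟨List.forall_mem_cons.mpr ⟨hs, hl⟩, by simp, by simp [bar, pos]⟩

theorem zetaSha_one_cons (p : ℤˣ) {l : List Entry} (hl : l = [] ∨ IsAdmissible l) :
    zetaSha ((1, p) :: l) = zetaStar ((1, p) :: l) := by
  have hindex : IsIndex l := by
    rcases hl with rfl | hl
    exacts [List.forall_mem_nil _, hl.1]
  rcases Int.units_eq_one_or p with rfl | rfl
  · change zetaSha (pos 1 :: l) = zetaStar (pos 1 :: l)
    have hdecay : (fun n => truncSum l n - eulerSum l) =O[atTop] invSqrt := by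
      rcases hl with rfl | hl
      exacts [isBigO_truncSum_nil_sub, isBigO_truncSum_sub_eulerSum hl]
    obtain ⟨c, -, hc⟩ := exists_hasExpansion_replicate_append hdecay 1
    simpa [Finset.sum_range_succ, zetaStar_nil, zetaSha_nil, zetaStar_singleton_pos_one,
      zetaSha_singleton_pos_one, sub_eq_zero]
      using hc.zetaSha_sub_zetaStar (l := pos 1 :: l)
        (List.forall_mem_cons.mpr ⟨le_rfl, hindex⟩)
  · exact zetaSha_eq_zetaStar_of_isAdmissible (isAdmissible_bar_cons le_rfl hindex)

theorem zetaSha_pos_one_pos_one_cons {l : List Entry} (hl : IsAdmissible l) :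
    zetaSha (pos 1 :: pos 1 :: l) =
      zetaStar (pos 1 :: pos 1 :: l) + C (1 / 2 * eulerSum [pos 2] * eulerSum l) := by
  obtain ⟨c, hc, h⟩ :=
    exists_hasExpansion_replicate_append (isBigO_truncSum_sub_eulerSum hl) 2
  have hindex : IsIndex (pos 1 :: pos 1 :: l) :=
    List.forall_mem_cons.mpr ⟨le_rfl, List.forall_mem_cons.mpr ⟨le_rfl, hl.1⟩⟩
  have hsub : zetaSha (pos 1 :: pos 1 :: l) - zetaStar (pos 1 :: pos 1 :: l) = C (eulerSum l) *
      (C (1 / 2) * X ^ 2 - C (1 / 2) * (X ^ 2 - C (eulerSum [pos 2]))) := by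
    simpa [Finset.sum_range_succ, zetaStar_nil, zetaSha_nil, zetaStar_singleton_pos_one, hc,
      zetaSha_singleton_pos_one, zetaSha_pos_one_pos_one, zetaStar_pos_one_pos_one]
      using h.zetaSha_sub_zetaStar hindex
  rw [C_mul, C_mul]
  linear_combination hsub

/-! ### Double shuffle relations -/

theorem insertIdx_replicate_append {α : Type*} (a x : α) (l : List α) {i k : ℕ} (hi : i ≤ k) :
    (List.replicate k a ++ l).insertIdx i x =
      List.replicate i a ++ x :: (List.replicate (k - i) a ++ l) := by
  induction i generalizing k with
  | zero => simp
  | succ i ih =>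
    obtain ⟨k, rfl⟩ : ∃ j, k = j + 1 := ⟨k - 1, by lia⟩
    simp [List.replicate_succ, ih (Nat.le_of_succ_le_succ hi)]

theorem truncInt_singleton_mul_pair (p q r : ℤˣ) (k : ℕ) {ε : ℝ} (hε : ε ∈ Set.Ioo (0 : ℝ) 1) :
    truncInt [(1, q)] ε * truncInt [(1, p), (k + 1, p * r)] ε =
      ∑ i ∈ Finset.range (k + 1), truncInt [(1, p), (i + 1, p * q), (k - i + 1, q * r)] ε +
        truncInt [(1, p), (k + 1, p * r), (1, r * q)] ε +
        truncInt [(1, q), (1, q * p), (k + 1, p * r)] ε := by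
  have hcancel (a b : ℤˣ) : a * (a * b) = b := by rw [← mul_assoc, Int.units_mul_self, one_mul]
  have hword : word 1 [(1, p), (k + 1, p * r)] =
      some p :: (List.replicate k none ++ [some r]) := by simp [word, hcancel]
  have hlast : (List.replicate k none ++ [some r]).insertIdx (k + 1) (some q) =
      List.replicate k none ++ [some r, some q] := by
    have hlength : (List.replicate k none ++ [some r]).length = k + 1 := by simp
    rw [← hlength, List.insertIdx_length_self, List.append_assoc, List.singleton_append]
  rw [truncInt_singleton_mul q _ hε, hword, List.length_cons, List.length_append,
    List.length_replicate, List.length_singleton, Finset.sum_range_succ', Finset.sum_range_succ]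
  simp only [List.insertIdx_succ_cons, List.insertIdx_zero, hlast]
  rw [Finset.sum_congr rfl fun i hi => by
    rw [insertIdx_replicate_append _ _ _ (Finset.mem_range_succ_iff.mp hi)]]
  simp [truncInt, forms_eq_map_word, word, hcancel]

theorem sum_pairs {β : Type*} [AddCommMonoid β] (k : ℕ) (f : ℕ × ℕ → β) :
    ∑ x ∈ pairs (k + 2), f x = ∑ i ∈ Finset.range (k + 1), f (i + 1, k - i + 1) := by
  symm
  refine Finset.sum_bij (fun i _ => (i + 1, k - i + 1)) ?_ ?_ ?_ fun _ _ => rfl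
  · intro i hi
    have := Finset.mem_range.mp hi
    simp only [pairs, Finset.mem_filter, Finset.HasAntidiagonal.mem_antidiagonal]
    lia
  · intro i _ j _ hij
    simpa using congrArg Prod.fst hij
  · rintro ⟨b, c⟩ hbc
    simp only [pairs, Finset.mem_filter, Finset.HasAntidiagonal.mem_antidiagonal] at hbc
    exact ⟨b - 1, Finset.mem_range.mpr (by lia), by ext <;> dsimp only <;> lia⟩

theorem zetaSha_singleton_mul_pair (p q r : ℤˣ) {u : ℕ} (hu : 1 ≤ u) :
    zetaSha [(1, q)] * zetaSha [(1, p), (u, p * r)] =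
      ∑ x ∈ pairs (u + 1), zetaSha [(1, p), (x.1, p * q), (x.2, q * r)] +
        zetaSha [(1, p), (u, p * r), (1, r * q)] + zetaSha [(1, q), (1, q * p), (u, p * r)] := by
  obtain ⟨k, rfl⟩ : ∃ k, u = k + 1 := ⟨u - 1, by lia⟩
  have hreg {l : List Entry} (hl : IsIndex l) := hasRegularization_truncInt hl
  have hfactors := (hreg (l := [(1, q)]) (by simp [IsIndex])).mul
    (hreg (l := [(1, p), (k + 1, p * r)]) (by simp [IsIndex]))
  rw [sum_pairs]
  refine hfactors.unique tendsto_shuffleVar <|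
    (((HasRegularization.sum fun i _ => hreg (by simp [IsIndex])).add
      (hreg (by simp [IsIndex]))).add (hreg (by simp [IsIndex]))).congr ?_
  filter_upwards [Ioo_mem_nhdsGT (one_pos : (0 : ℝ) < 1)] with ε hε
  exact (truncInt_singleton_mul_pair p q r k hε).symm

theorem zetaStar_singleton_mul_pair (p q z : ℤˣ) {u : ℕ} (hu : 1 ≤ u) :
    zetaStar [(1, q)] * zetaStar [(1, p), (u, z)] =
      zetaStar [(1, q), (1, p), (u, z)] + zetaStar [(1, p), (1, q), (u, z)] +
        zetaStar [(1, p), (u, z), (1, q)] + zetaStar [(2, q * p), (u, z)] +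
        zetaStar [(1, p), (u + 1, q * z)] := by
  have hstuffle := zetaStar_singleton_mul (e := (1, q)) (l := [(1, p), (u, z)]) le_rfl
    (by simp [IsIndex, hu])
  simp only [List.length_cons, List.length_nil, Finset.sum_range_succ, Finset.sum_range_zero]
    at hstuffle
  simpa [merge, add_assoc, add_comm 1 u] using hstuffle

theorem sum_zetaSha (p q r : ℤˣ) {u : ℕ} (hu : 2 ≤ u) :
    ∑ x ∈ pairs (u + 1), zetaSha [(1, p), (x.1, p * q), (x.2, q * r)] =
      zetaStar [(1, q), (1, p), (u, p * r)] + zetaStar [(1, p), (1, q), (u, p * r)] +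
        zetaStar [(1, p), (u, p * r), (1, q)] + C (eulerSum [(2, q * p), (u, p * r)]) +
        zetaStar [(1, p), (u + 1, q * (p * r))] -
        zetaSha [(1, p), (u, p * r), (1, r * q)] - zetaSha [(1, q), (1, q * p), (u, p * r)] := by
  have hu' : 1 ≤ u := one_le_two.trans hu
  have hpair : zetaSha [(1, p), (u, p * r)] = zetaStar [(1, p), (u, p * r)] :=
    zetaSha_one_cons p (.inr (isAdmissible_cons_of_two_le hu _ (List.forall_mem_nil _)))
  have htwo : zetaStar [(2, q * p), (u, p * r)] = C (eulerSum [(2, q * p), (u, p * r)]) :=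
    zetaStar_eq_C_eulerSum (isAdmissible_cons_of_two_le le_rfl _ (by simp [IsIndex, hu']))
  have hshuffle := zetaSha_singleton_mul_pair p q r hu'
  rw [zetaSha_one_cons q (.inl rfl), hpair, zetaStar_singleton_mul_pair p q _ hu', htwo]
    at hshuffle
  linear_combination -hshuffle

/-! ### The sum formulas -/

theorem zetaStar_bar_one_cons {l : List Entry} (hl : IsIndex l) :
    zetaStar ((1, -1) :: l) = C (eulerSum ((1, -1) :: l)) :=
  zetaStar_eq_C_eulerSum (isAdmissible_bar_cons le_rfl hl)

theorem zetaSha_bar_one_cons {l : List Entry} (hl : IsIndex l) :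
    zetaSha ((1, -1) :: l) = C (eulerSum ((1, -1) :: l)) :=
  zetaSha_eq_C_eulerSum (isAdmissible_bar_cons le_rfl hl)

theorem isIndex_pair {s t : ℕ} (hs : 1 ≤ s) (ht : 1 ≤ t) (y z : ℤˣ) :
    IsIndex [(s, y), (t, z)] := by
  simp [IsIndex, hs, ht]

theorem sum_zetaSha_pos_one_pos (z : ℤˣ) {u : ℕ} (hu : 2 ≤ u) :
    ∑ x ∈ pairs (u + 1), zetaSha [pos 1, pos x.1, (x.2, z)] =
      C (eulerSum [pos 2, (u, z)]) + zetaStar [pos 1, (u + 1, z)] +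
        zetaStar [pos 1, pos 1, (u, z)] + zetaStar [pos 1, (u, z), pos 1] -
        zetaSha [pos 1, (u, z), (1, z)] - C (1 / 2 * eulerSum [pos 2] * eulerSum [(u, z)]) := by
  have hsum := sum_zetaSha 1 1 z hu
  have hcompare := zetaSha_pos_one_pos_one_cons
    (isAdmissible_cons_of_two_le hu z (List.forall_mem_nil _))
  simp only [one_mul, mul_one, pos] at hsum hcompare ⊢
  linear_combination hsum - hcompare

theorem sum_zetaSha_pos_one_bar (z : ℤˣ) {u : ℕ} (hu : 2 ≤ u) :
    ∑ x ∈ pairs (u + 1), zetaSha [pos 1, bar x.1, (x.2, -z)] =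
      C (eulerSum [bar 2, (u, z)]) + zetaStar [pos 1, (u + 1, -z)] +
        zetaStar [pos 1, bar 1, (u, z)] + zetaStar [pos 1, (u, z), bar 1] +
        C (eulerSum [bar 1, pos 1, (u, z)]) - C (eulerSum [bar 1, bar 1, (u, z)]) -
        zetaStar [pos 1, (u, z), (1, -z)] := by
  have hsum := sum_zetaSha 1 (-1) z hu
  have hcompare : zetaSha [(1, 1), (u, z), (1, -z)] = zetaStar [(1, 1), (u, z), (1, -z)] :=
    zetaSha_one_cons 1 (.inr (isAdmissible_cons_of_two_le hu z (by simp [IsIndex])))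
  have hindex (p : ℤˣ) : IsIndex [(1, p), (u, z)] := isIndex_pair le_rfl (one_le_two.trans hu) p z
  simp only [one_mul, mul_one, neg_mul, mul_neg, hcompare, zetaStar_bar_one_cons (hindex _),
    zetaSha_bar_one_cons (hindex _)] at hsum
  simp only [pos, bar]
  linear_combination hsum

theorem C_sum_eulerSum_bar_one (p z : ℤˣ) (n : ℕ) :
    C (∑ x ∈ pairs n, eulerSum [(1, -1), (x.1, p), (x.2, z)]) =
      ∑ x ∈ pairs n, zetaSha [(1, -1), (x.1, p), (x.2, z)] := by
  rw [map_sum]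
  refine Finset.sum_congr rfl fun x hx => (zetaSha_bar_one_cons ?_).symm
  obtain ⟨-, hb, hc⟩ := Finset.mem_filter.mp hx
  exact isIndex_pair hb hc p z

theorem sum_eulerSum_bar_one_bar (z : ℤˣ) {u : ℕ} (hu : 2 ≤ u) :
    ∑ x ∈ pairs (u + 1), eulerSum [bar 1, bar x.1, (x.2, -z)] =
      eulerSum [bar 2, (u, z)] + eulerSum [bar 1, (u + 1, z)] + eulerSum [bar 1, pos 1, (u, z)] +
        eulerSum [bar 1, (u, z), pos 1] - eulerSum [bar 1, (u, z), (1, -z)] := by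
  have hu' : 1 ≤ u := one_le_two.trans hu
  have hsum := sum_zetaSha (-1) 1 (-z) hu
  have hlast : IsIndex [(u + 1, z)] := by simp [IsIndex]
  have hcompare : zetaSha [(1, 1), (1, -1), (u, z)] = zetaStar [(1, 1), (1, -1), (u, z)] :=
    zetaSha_one_cons 1 (.inr (isAdmissible_bar_cons le_rfl (by simp [IsIndex, hu'])))
  have hleft (y z : ℤˣ) : IsIndex [(1, y), (u, z)] := isIndex_pair le_rfl hu' y z
  have hright (y z : ℤˣ) : IsIndex [(u, y), (1, z)] := isIndex_pair hu' le_rfl y z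
  refine C_injective ?_
  simp only [pos, bar, C_sum_eulerSum_bar_one, C_add, C_sub]
  simp only [one_mul, mul_one, neg_mul, neg_neg, hcompare, zetaStar_bar_one_cons hlast,
    zetaStar_bar_one_cons (hleft _ _), zetaStar_bar_one_cons (hright _ _),
    zetaSha_bar_one_cons (hright _ _)] at hsum
  linear_combination hsum

theorem sum_eulerSum_bar_one_pos (z : ℤˣ) {u : ℕ} (hu : 2 ≤ u) :
    ∑ x ∈ pairs (u + 1), eulerSum [bar 1, pos x.1, (x.2, z)] =
      eulerSum [pos 2, (u, z)] + eulerSum [bar 1, (u + 1, -z)] + eulerSum [bar 1, (u, z), bar 1] +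
        2 * eulerSum [bar 1, bar 1, (u, z)] - eulerSum [bar 1, pos 1, (u, z)] -
        eulerSum [bar 1, (u, z), (1, z)] := by
  have hu' : 1 ≤ u := one_le_two.trans hu
  have hsum := sum_zetaSha (-1) (-1) (-z) hu
  have hlast : IsIndex [(u + 1, -z)] := by simp [IsIndex]
  have hleft (y z : ℤˣ) : IsIndex [(1, y), (u, z)] := isIndex_pair le_rfl hu' y z
  have hright (y z : ℤˣ) : IsIndex [(u, y), (1, z)] := isIndex_pair hu' le_rfl y z
  refine C_injective ?_
  simp only [pos, bar, C_sum_eulerSum_bar_one, C_add, C_sub, C_mul, C_ofNat]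
  simp only [one_mul, mul_one, neg_mul, mul_neg, neg_neg, zetaStar_bar_one_cons hlast,
    zetaStar_bar_one_cons (hleft _ _), zetaStar_bar_one_cons (hright _ _),
    zetaSha_bar_one_cons (hleft _ _), zetaSha_bar_one_cons (hright _ _)] at hsum
  linear_combination hsum

end EulerSums

theorem mainTheorem11_general :
    (∀ l : List Entry, IsAdmissible l → Tendsto (truncSum l) atTop (𝓝 (eulerSum l))) ∧
    (∀ l : List Entry, IsIndex l → IsStuffleReg l (zetaStar l) ∧ IsShuffleReg l (zetaSha l)) ∧
    (∀ w u v : ℕ, 4 ≤ w → u + 2 = w → v + 1 = w →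
      (∑ p ∈ pairs (w - 1), zetaSha [pos 1, pos p.1, pos p.2]
          = C (eulerSum [pos 2, pos u]) + zetaStar [pos 1, pos v]
            + zetaStar [pos 1, pos 1, pos u]
            - C (1 / 2 * eulerSum [pos 2] * eulerSum [pos u])) ∧
      (∑ p ∈ pairs (w - 1), zetaSha [pos 1, bar p.1, pos p.2]
          = C (eulerSum [bar 2, bar u]) + zetaStar [pos 1, pos v]
            + zetaStar [pos 1, bar 1, bar u] + zetaStar [pos 1, bar u, bar 1]
            + C (eulerSum [bar 1, pos 1, bar u]) - C (eulerSum [bar 1, bar 1, bar u])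
            - zetaStar [pos 1, bar u, pos 1]) ∧
      (∑ p ∈ pairs (w - 1), eulerSum [bar 1, pos p.1, pos p.2]
          = eulerSum [pos 2, pos u] + eulerSum [bar 1, bar v]
            + eulerSum [bar 1, pos u, bar 1] + 2 * eulerSum [bar 1, bar 1, pos u]
            - eulerSum [bar 1, pos 1, pos u] - eulerSum [bar 1, pos u, pos 1]) ∧
      (∑ p ∈ pairs (w - 1), eulerSum [bar 1, bar p.1, pos p.2]
          = eulerSum [bar 2, bar u] + eulerSum [bar 1, bar v]
            + eulerSum [bar 1, pos 1, bar u]) ∧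
      (∑ p ∈ pairs (w - 1), eulerSum [bar 1, bar p.1, bar p.2]
          = eulerSum [bar 2, pos u] + eulerSum [bar 1, pos v]
            + eulerSum [bar 1, pos u, pos 1] + eulerSum [bar 1, pos 1, pos u]
            - eulerSum [bar 1, pos u, bar 1]) ∧
      (∑ p ∈ pairs (w - 1), zetaSha [pos 1, pos p.1, bar p.2]
          = C (eulerSum [pos 2, bar u]) + zetaStar [pos 1, bar v]
            + zetaStar [pos 1, bar u, pos 1] + zetaStar [pos 1, pos 1, bar u]
            - zetaSha [pos 1, bar u, bar 1]
            - C (1 / 2 * eulerSum [pos 2] * eulerSum [bar u])) ∧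
      (∑ p ∈ pairs (w - 1), zetaSha [pos 1, bar p.1, bar p.2]
          = C (eulerSum [bar 2, pos u]) + zetaStar [pos 1, bar v]
            + zetaStar [pos 1, bar 1, pos u] + C (eulerSum [bar 1, pos 1, pos u])
            - C (eulerSum [bar 1, bar 1, pos u])) ∧
      (∑ p ∈ pairs (w - 1), eulerSum [bar 1, pos p.1, bar p.2]
          = eulerSum [pos 2, bar u] + eulerSum [bar 1, pos v]
            + 2 * eulerSum [bar 1, bar 1, bar u] - eulerSum [bar 1, pos 1, bar u])) := by
  refine ⟨fun l hl => tendsto_truncSum hl, fun l hl =>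
    ⟨(hasRegularization_truncSum hl).tendsto, (hasRegularization_truncInt hl).tendsto⟩, ?_⟩
  rintro w u v hw hwu rfl
  obtain rfl : v = u + 1 := by lia
  have hu : 2 ≤ u := by lia
  have hcompare : zetaSha [pos 1, pos u, pos 1] = zetaStar [pos 1, pos u, pos 1] :=
    zetaSha_one_cons 1 (.inr (isAdmissible_cons_of_two_le hu 1 (isIndex_replicate_pos_one 1)))
  have hpos_pos (z : ℤˣ) := sum_zetaSha_pos_one_pos z hu
  have hpos_bar (z : ℤˣ) := sum_zetaSha_pos_one_bar z hu
  have hbar_pos (z : ℤˣ) := sum_eulerSum_bar_one_pos z hu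
  have hbar_bar (z : ℤˣ) := sum_eulerSum_bar_one_bar z hu
  simp only [pos, bar, Nat.add_sub_cancel] at hcompare hpos_pos hpos_bar hbar_pos hbar_bar ⊢
  refine ⟨?_, ?_, hbar_pos 1, ?_, ?_, ?_, ?_, ?_⟩
  · linear_combination hpos_pos 1 - hcompare
  · simpa only [neg_neg] using hpos_bar (-1)
  · have hsum := hbar_bar (-1)
    rw [neg_neg] at hsum
    linear_combination hsum
  · linear_combination hbar_bar 1
  · linear_combination hpos_pos (-1)
  · linear_combination hpos_bar 1
  · have hsum := hbar_pos (-1)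
    rw [neg_neg] at hsum
    linear_combination hsum

theorem mainTheorem11 :
    -- the values below exist: the series converge and the regularizations are as specified
    (∀ l : List Entry, IsAdmissible l → l.length ≤ 3 →
      Tendsto (truncSum l) atTop (𝓝 (eulerSum l))) ∧
    (∀ l : List Entry, IsIndex l → l.length ≤ 3 →
      IsStuffleReg l (zetaStar l) ∧ IsShuffleReg l (zetaSha l)) ∧
    -- the eight sum formulas
    (∀ w u v : ℕ, 4 ≤ w → u + 2 = w → v + 1 = w →
      (∑ p ∈ pairs (w - 1), zetaSha [pos 1, pos p.1, pos p.2]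
          = C (eulerSum [pos 2, pos u]) + zetaStar [pos 1, pos v]
            + zetaStar [pos 1, pos 1, pos u]
            - C (1 / 2 * eulerSum [pos 2] * eulerSum [pos u])) ∧
      (∑ p ∈ pairs (w - 1), zetaSha [pos 1, bar p.1, pos p.2]
          = C (eulerSum [bar 2, bar u]) + zetaStar [pos 1, pos v]
            + zetaStar [pos 1, bar 1, bar u] + zetaStar [pos 1, bar u, bar 1]
            + C (eulerSum [bar 1, pos 1, bar u]) - C (eulerSum [bar 1, bar 1, bar u])
            - zetaStar [pos 1, bar u, pos 1]) ∧
      (∑ p ∈ pairs (w - 1), eulerSum [bar 1, pos p.1, pos p.2]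
          = eulerSum [pos 2, pos u] + eulerSum [bar 1, bar v]
            + eulerSum [bar 1, pos u, bar 1] + 2 * eulerSum [bar 1, bar 1, pos u]
            - eulerSum [bar 1, pos 1, pos u] - eulerSum [bar 1, pos u, pos 1]) ∧
      (∑ p ∈ pairs (w - 1), eulerSum [bar 1, bar p.1, pos p.2]
          = eulerSum [bar 2, bar u] + eulerSum [bar 1, bar v]
            + eulerSum [bar 1, pos 1, bar u]) ∧
      (∑ p ∈ pairs (w - 1), eulerSum [bar 1, bar p.1, bar p.2]
          = eulerSum [bar 2, pos u] + eulerSum [bar 1, pos v]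
            + eulerSum [bar 1, pos u, pos 1] + eulerSum [bar 1, pos 1, pos u]
            - eulerSum [bar 1, pos u, bar 1]) ∧
      (∑ p ∈ pairs (w - 1), zetaSha [pos 1, pos p.1, bar p.2]
          = C (eulerSum [pos 2, bar u]) + zetaStar [pos 1, bar v]
            + zetaStar [pos 1, bar u, pos 1] + zetaStar [pos 1, pos 1, bar u]
            - zetaSha [pos 1, bar u, bar 1]
            - C (1 / 2 * eulerSum [pos 2] * eulerSum [bar u])) ∧
      (∑ p ∈ pairs (w - 1), zetaSha [pos 1, bar p.1, bar p.2]
          = C (eulerSum [bar 2, pos u]) + zetaStar [pos 1, bar v]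
            + zetaStar [pos 1, bar 1, pos u] + C (eulerSum [bar 1, pos 1, pos u])
            - C (eulerSum [bar 1, bar 1, pos u])) ∧
      (∑ p ∈ pairs (w - 1), eulerSum [bar 1, pos p.1, bar p.2]
          = eulerSum [pos 2, bar u] + eulerSum [bar 1, pos v]
            + 2 * eulerSum [bar 1, bar 1, bar u] - eulerSum [bar 1, pos 1, bar u])) :=
  let ⟨hvalues, hreg, hsums⟩ := mainTheorem11_general
  ⟨fun l hl _ => hvalues l hl, fun l hl _ => hreg l hl, hsums⟩
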